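/- There is a universal constant $C>0$ such that the following holds. Let $n\ge 1$, let $b_{ij}\ge 0$ ($1\le i,j\le n$) be real numbers with $b_{ij}=b_{ji}$, and let $g_{ij}$ ($1\le i,j\le n$) be standard Gaussian random variables on a probability space such that $g_{ij}=g_{ji}$ and the variables $(g_{ij})_{1\le j\le i\le n}$ are independent. Let $X$ be the $n\times n$ symmetric random matrix with entries $X_{ij}=b_{ij}g_{ij}$, and let $\|X\|$ denote its spectral norm, that is, its largest singular value. Then $\|X\|$ is integrable and $$ \mathbf{E}\|X\| \le C\left(\max_{1\le i\le n}\Big(\sum_{j=1}^n b_{ij}^2\Big)^{1/2}+\Big(\sum_{i,j=1}^n b_{ij}^4\Big)^{1/4}\right). $$ -/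

import Mathlib

open MeasureTheory ProbabilityTheory

/-- The spectral norm of a real square matrix: its largest singular value
(singular values are listed in decreasing order, starting from index `0`). -/
noncomputable def specNorm {n : ℕ} (A : Matrix (Fin n) (Fin n) ℝ) : ℝ :=
  (Matrix.toEuclideanLin A).singularValues 0

open scoped Matrix.Norms.L2Operator in
/-- The spectral norm is the operator norm on Euclidean space. -/
theorem specNorm_eq_l2_opNorm {n : ℕ} (A : Matrix (Fin n) (Fin n) ℝ) : specNorm A = ‖A‖ := by
  classical
  set T := Matrix.toEuclideanLin A with hT
  have hnorm : ‖A‖ = ‖LinearMap.toContinuousLinearMap T‖ := rfl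
  have hfr : Module.finrank ℝ (EuclideanSpace ℝ (Fin n)) = n := finrank_euclideanSpace_fin
  have hS := T.isSymmetric_adjoint_comp_self
  have hsq : ∀ x : EuclideanSpace ℝ (Fin n),
      ‖T x‖ ^ 2 = ∑ i, hS.eigenvalues hfr i * inner ℝ (hS.eigenvectorBasis hfr i) x ^ 2 := by
    intro x
    have h1 : ‖T x‖ ^ 2 = inner ℝ ((T.adjoint ∘ₗ T) x) x := by
      rw [LinearMap.comp_apply, LinearMap.adjoint_inner_left, real_inner_self_eq_norm_sq]
    rw [h1, ← (hS.eigenvectorBasis hfr).sum_inner_mul_inner]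
    refine Finset.sum_congr rfl fun i _ => ?_
    rw [hS x, hS.apply_eigenvectorBasis hfr i, inner_smul_right,
      real_inner_comm x]
    simp only [RCLike.ofReal_real_eq_id, id_eq]
    ring
  have hx : ∀ x : EuclideanSpace ℝ (Fin n),
      ‖x‖ ^ 2 = ∑ i, inner ℝ (hS.eigenvectorBasis hfr i) x ^ 2 := by
    intro x
    rw [← real_inner_self_eq_norm_sq, ← (hS.eigenvectorBasis hfr).sum_inner_mul_inner]
    refine Finset.sum_congr rfl fun i _ => ?_
    rw [real_inner_comm x]
    ring
  change T.singularValues 0 = ‖A‖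
  rw [hnorm]
  apply le_antisymm
  · rcases Nat.eq_zero_or_pos n with h0 | h0
    · rw [T.singularValues_of_finrank_le (by omega)]
      exact norm_nonneg _
    · have h2 := T.sq_singularValues_fin hfr ⟨0, h0⟩
      have h3 := (LinearMap.toContinuousLinearMap T).le_opNorm
        (hS.eigenvectorBasis hfr ⟨0, h0⟩)
      rw [(hS.eigenvectorBasis hfr).norm_eq_one, mul_one,
        LinearMap.coe_toContinuousLinearMap'] at h3
      have h4 := hsq (hS.eigenvectorBasis hfr ⟨0, h0⟩)
      simp only [OrthonormalBasis.inner_eq_ite] at h4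
      simp at h4 h2
      refine le_trans (le_of_eq ?_) h3
      rw [← sq_eq_sq₀ (T.singularValues_nonneg 0) (norm_nonneg _), h2, h4]
  · refine ContinuousLinearMap.opNorm_le_bound _ (T.singularValues_nonneg 0) fun x => ?_
    rw [LinearMap.coe_toContinuousLinearMap']
    refine le_of_sq_le_sq ?_ (mul_nonneg (T.singularValues_nonneg 0) (norm_nonneg _))
    rw [mul_pow, hsq, hx, Finset.mul_sum]
    refine Finset.sum_le_sum fun i _ => mul_le_mul_of_nonneg_right ?_ (sq_nonneg _)
    rw [← T.sq_singularValues_fin hfr i]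
    exact pow_le_pow_left₀ (T.singularValues_nonneg _)
      (T.singularValues_antitone (Nat.zero_le _)) 2

/-- The random matrix `X` with entries `X i j = b i j * g i j`. -/
def randomMatrix {n : ℕ} {Ω : Type*} (b : Fin n → Fin n → ℝ) (g : Fin n → Fin n → Ω → ℝ)
    (ω : Ω) : Matrix (Fin n) (Fin n) ℝ :=
  Matrix.of fun i j => b i j * g i j ω

/-! The norm of a symmetric matrix is, up to a factor 2, the supremum of |⟨v, Xv⟩| over a finite net
of the unit ball (`exists_net_specNorm`), so it suffices to bound the supremum of the Gaussian
process v ↦ ±⟨v, Xv⟩. This is done by Sudakov–Fernique comparison (`sudakov_fernique`) with a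
process that is easier to bound.

Write β_ij = b_ij² and p_i(v) = (∑_j β_ij v_j²)^{1/2}. The increments of ⟨v, Xv⟩ are bounded by ∑_i
(v_i - w_i)² (p_i(v)² + p_i(w)²). The natural comparison process ∑_i v_i p_i(v) g_i dominates this
only up to the cross term ∑_ij β_ij (v_i² - w_i²)(v_j² - w_j²), which can be negative since β need
not be positive semidefinite. Adding |β| repairs this: with S a square root of |β|, an independent
process ∑_k (∑_i S_ki v_i²) h_k absorbs the negative part (`exists_psd_compensator`,
`sum_sq_sub_mul_le`).

By Cauchy–Schwarz, the first process is at most max_j (∑_i β_ij g_i²)^{1/2}. Centring the g_i² gives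
the row term σ and a fluctuation whose second moment is of order ∑ b_ij⁴. The second process is a
subconvex combination of the Gaussians ∑_k S_ki h_k, hence at most their maximum with 0. Their
variances are |β|_ii ≤ (∑_j b_ij⁴)^{1/2}, and a second comparison, with independent variables,
followed by a fourth moment bound gives (∑ b_ij⁴)^{1/4}. -/

/-! ### Gaussian integration by parts. -/

/-- The standard Gaussian measure on `ι → ℝ`. -/
noncomputable abbrev stdGauss (ι : Type*) [Fintype ι] : Measure (ι → ℝ) :=
  Measure.pi fun _ => gaussianReal 0 1

theorem hasDerivAt_gaussianPDFReal (x : ℝ) :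
    HasDerivAt (gaussianPDFReal 0 1) (-x * gaussianPDFReal 0 1 x) x := by
  have h : gaussianPDFReal 0 1 = fun x => (√(2 * Real.pi))⁻¹ * Real.exp (-(x ^ 2) / 2) := by
    ext x; simp [gaussianPDFReal]
  rw [h]
  have h1 : HasDerivAt (fun x : ℝ => -(x ^ 2) / 2) (-x) x := by
    have := ((hasDerivAt_pow 2 x).neg).div_const 2
    refine this.congr_deriv ?_
    simp; ring
  refine ((h1.exp).const_mul _).congr_deriv ?_
  ring

theorem integrable_pow_gaussianReal (k : ℕ) : Integrable (fun x : ℝ => x ^ k) (gaussianReal 0 1) := by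
  have := (memLp_id_gaussianReal (μ := 0) (v := 1) (k : NNReal)).integrable_norm_pow'
  rw [← integrable_norm_iff (by fun_prop)]
  simpa using this

theorem integrable_id_gaussianReal : Integrable (fun x : ℝ => x) (gaussianReal 0 1) := by
  simpa using integrable_pow_gaussianReal 1

theorem integrable_gaussianReal_iff {f : ℝ → ℝ} :
    Integrable f (gaussianReal 0 1) ↔ Integrable fun x => gaussianPDFReal 0 1 x * f x := by
  rw [gaussianReal_of_var_ne_zero 0 one_ne_zero, gaussianPDF_def,
    integrable_withDensity_iff_integrable_smul₀' (by fun_prop) (by simp)]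
  simp [gaussianPDFReal_nonneg]

/-- Gaussian integration by parts on the line. -/
theorem gaussianReal_integral_mul {h h' : ℝ → ℝ} (hd : ∀ x, HasDerivAt h (h' x) x) {A B : ℝ}
    (hA : ∀ x, |h x| ≤ A) (hB : ∀ x, |h' x| ≤ B) :
    ∫ x, x * h x ∂gaussianReal 0 1 = ∫ x, h' x ∂gaussianReal 0 1 := by
  have hc : Continuous h := continuous_iff_continuousAt.2 fun x => (hd x).continuousAt
  have hh' : h' = deriv h := funext fun x => (hd x).deriv.symm
  have hm' : Measurable h' := hh' ▸ measurable_deriv h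
  have i1 : Integrable h (gaussianReal 0 1) :=
    Integrable.of_bound hc.aestronglyMeasurable A (.of_forall hA)
  have i2 : Integrable h' (gaussianReal 0 1) :=
    Integrable.of_bound hm'.aestronglyMeasurable B (.of_forall hB)
  have i3 : Integrable (fun x => x * h x) (gaussianReal 0 1) :=
    integrable_id_gaussianReal.mul_bdd (c := A) hc.aestronglyMeasurable (.of_forall hA)
  rw [integrable_gaussianReal_iff] at i1 i2 i3
  have key := integral_mul_deriv_eq_deriv_mul_of_integrable (u := h) (u' := h')
    (v := gaussianPDFReal 0 1) (v' := fun x => -x * gaussianPDFReal 0 1 x)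
    (fun x _ => hd x) (fun x _ => hasDerivAt_gaussianPDFReal x)
    (by refine i3.neg.congr (.of_forall fun x => ?_); simp; ring)
    (by refine i2.congr (.of_forall fun x => ?_); simp; ring)
    (by refine i1.congr (.of_forall fun x => ?_); simp; ring)
  rw [integral_gaussianReal_eq_integral_smul one_ne_zero,
    integral_gaussianReal_eq_integral_smul one_ne_zero]
  simp only [smul_eq_mul]
  have e1 : ∫ x, gaussianPDFReal 0 1 x * (x * h x) = -∫ x, h x * (-x * gaussianPDFReal 0 1 x) := by
    rw [← integral_neg]; congr 1; ext x; ring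
  rw [e1, key, neg_neg]
  congr 1; ext x; ring

section Pi
variable {ι : Type*} [Fintype ι] [DecidableEq ι]

/-- Resampling one coordinate independently does not change a product law. It lets Fubini isolate
that coordinate without splitting the index type. -/
theorem measurePreserving_update {X : ι → Type*} [∀ i, MeasurableSpace (X i)]
    (μ : ∀ i, Measure (X i)) [∀ i, IsProbabilityMeasure (μ i)] (k : ι) :
    MeasurePreserving (fun p : (∀ i, X i) × X k => Function.update p.1 k p.2)
      ((Measure.pi μ).prod (μ k)) (Measure.pi μ) := by
  have hm : Measurable (fun p : (∀ i, X i) × X k => Function.update p.1 k p.2) := by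
    refine measurable_pi_iff.2 fun i => ?_
    rcases eq_or_ne i k with rfl | h
    · simpa using measurable_snd
    · simp only [Function.update_of_ne h]; fun_prop
  refine ⟨hm, (Measure.pi_eq fun s hs => ?_).symm⟩
  rw [Measure.map_apply hm (.univ_pi hs)]
  have : (fun p : (∀ i, X i) × X k => Function.update p.1 k p.2) ⁻¹' Set.univ.pi s =
      (Set.univ.pi (Function.update s k Set.univ)) ×ˢ s k := by
    ext p
    simp only [Set.mem_preimage, Set.mem_pi, Set.mem_univ, true_imp_iff, Set.mem_prod]
    constructor
    · refine fun h => ⟨fun i => ?_, by simpa using h k⟩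
      rcases eq_or_ne i k with rfl | hi
      · simp
      · simpa [hi] using h i
    · rintro ⟨h1, h2⟩ i
      rcases eq_or_ne i k with rfl | hi
      · simpa using h2
      · simpa [hi] using h1 i
  rw [this, Measure.prod_prod, Measure.pi_pi, ← Finset.mul_prod_erase _ _ (Finset.mem_univ k),
    ← Finset.mul_prod_erase (Finset.univ) (fun i => μ i (s i)) (Finset.mem_univ k)]
  simp only [Function.update_self, measure_univ, one_mul]
  rw [mul_comm]
  congr 1
  refine Finset.prod_congr rfl fun i hi => ?_
  rw [Function.update_of_ne (Finset.ne_of_mem_erase hi)]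

/-- Gaussian integration by parts in one coordinate. -/
theorem stdGauss_integral_mul (k : ι) {f f' : (ι → ℝ) → ℝ} (hf : Measurable f) (hf' : Measurable f')
    (hd : ∀ x, HasDerivAt (fun s => f (Function.update x k s)) (f' x) (x k)) {A B : ℝ}
    (hA : ∀ x, |f x| ≤ A) (hB : ∀ x, |f' x| ≤ B) :
    ∫ x, x k * f x ∂stdGauss ι = ∫ x, f' x ∂stdGauss ι := by
  have mp := measurePreserving_update (fun _ : ι => gaussianReal 0 1) k
  have hi : Integrable (fun x : ι → ℝ => x k) (stdGauss ι) :=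
    integrable_comp_eval (μ := fun _ : ι => gaussianReal 0 1) (i := k) (f := fun x : ℝ => x)
      integrable_id_gaussianReal
  have hi1 : Integrable (fun x : ι → ℝ => x k * f x) (stdGauss ι) :=
    hi.mul_bdd (c := A) hf.aestronglyMeasurable (.of_forall hA)
  have hi2 : Integrable f' (stdGauss ι) :=
    Integrable.of_bound hf'.aestronglyMeasurable B (.of_forall hB)
  have e (F : (ι → ℝ) → ℝ) (hF : Integrable F (stdGauss ι)) : ∫ x, F x ∂stdGauss ι =
      ∫ x, ∫ s, F (Function.update x k s) ∂gaussianReal 0 1 ∂stdGauss ι := by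
    have h1 := integral_map (μ := (stdGauss ι).prod (gaussianReal 0 1)) mp.aemeasurable
      (f := F) (by rw [mp.map_eq]; exact hF.aestronglyMeasurable)
    rw [mp.map_eq] at h1
    rw [h1]
    exact integral_prod _ (mp.integrable_comp_of_integrable hF)
  rw [e _ hi1, e _ hi2]
  congr 1
  ext x
  simp only [Function.update_self]
  refine gaussianReal_integral_mul (A := A) (B := B) (fun s => ?_) (fun _ => hA _) (fun _ => hB _)
  simpa using hd (Function.update x k s)

end Pi

theorem stdGauss_reindex {ι κ : Type*} [Fintype ι] [Fintype κ] {e : ι → κ}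
    (he : Function.Injective e) :
    MeasurePreserving (fun (x : κ → ℝ) i => x (e i)) (stdGauss κ) (stdGauss ι) := by
  refine ⟨by fun_prop, ?_⟩
  have h : iIndepFun (fun (i : κ) (x : κ → ℝ) => x i) (stdGauss κ) :=
    iIndepFun_pi (μ := fun _ : κ => gaussianReal 0 1) (X := fun _ => id) (fun _ => aemeasurable_id)
  have h2 := h.precomp he
  rw [iIndepFun_iff_map_fun_eq_pi_map (fun i => (measurable_pi_apply _).aemeasurable)] at h2
  rw [h2]
  congr 1
  ext1 i
  exact (measurePreserving_eval (fun _ : κ => gaussianReal 0 1) (e i)).map_eq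

/-! ### The soft maximum and its derivatives. -/

section LogSumExp
variable {T : Type*} [Fintype T]

/-- The soft maximum `log ∑ exp (y t)`. -/
noncomputable def logSumExp (y : T → ℝ) : ℝ := Real.log (∑ t, Real.exp (y t))

/-- The Gibbs weights, the gradient of `logSumExp`. -/
noncomputable def softmax (y : T → ℝ) (t : T) : ℝ := Real.exp (y t) / ∑ u, Real.exp (y u)

theorem softmax_nonneg (y : T → ℝ) (t : T) : 0 ≤ softmax y t := by
  unfold softmax; positivity

theorem softmax_le_one (y : T → ℝ) (t : T) : softmax y t ≤ 1 := by
  unfold softmax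
  refine div_le_one_of_le₀ ?_ (by positivity)
  exact Finset.single_le_sum (f := fun u => Real.exp (y u)) (fun _ _ => by positivity)
    (Finset.mem_univ t)

theorem abs_softmax_le_one (y : T → ℝ) (t : T) : |softmax y t| ≤ 1 := by
  rw [abs_of_nonneg (softmax_nonneg y t)]; exact softmax_le_one y t

theorem hasDerivAt_sum_exp {y : ℝ → T → ℝ} {y' : T → ℝ} {s : ℝ}
    (h : ∀ t, HasDerivAt (fun r => y r t) (y' t) s) :
    HasDerivAt (fun r => ∑ t, Real.exp (y r t)) (∑ t, Real.exp (y s t) * y' t) s :=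
  HasDerivAt.fun_sum fun t _ => (h t).exp

variable [Nonempty T]

theorem sum_exp_pos (y : T → ℝ) : 0 < ∑ t, Real.exp (y t) :=
  Finset.sum_pos (fun _ _ => Real.exp_pos _) Finset.univ_nonempty

theorem sum_softmax (y : T → ℝ) : ∑ t, softmax y t = 1 := by
  unfold softmax
  rw [← Finset.sum_div, div_self (sum_exp_pos y).ne']

theorem continuous_logSumExp : Continuous (logSumExp : (T → ℝ) → ℝ) := by
  unfold logSumExp
  exact Continuous.log (by fun_prop) fun y => (sum_exp_pos y).ne'

theorem continuous_softmax (t : T) : Continuous fun y : T → ℝ => softmax y t := by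
  unfold softmax
  exact Continuous.div (by fun_prop) (by fun_prop) fun y => (sum_exp_pos y).ne'

theorem le_logSumExp (y : T → ℝ) (t : T) : y t ≤ logSumExp y := by
  unfold logSumExp
  rw [Real.le_log_iff_exp_le (sum_exp_pos y)]
  exact Finset.single_le_sum (f := fun u => Real.exp (y u)) (fun _ _ => by positivity)
    (Finset.mem_univ t)

/-- The additive error does not depend on `y`, so it disappears after rescaling `y`. -/
theorem logSumExp_le {y : T → ℝ} {M : ℝ} (h : ∀ t, y t ≤ M) :
    logSumExp y ≤ M + Real.log (Fintype.card T) := by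
  unfold logSumExp
  rw [Real.log_le_iff_le_exp (sum_exp_pos y), Real.exp_add, Real.exp_log (by positivity)]
  refine (Finset.sum_le_sum fun t _ => Real.exp_le_exp.2 (h t)).trans_eq ?_
  simp [mul_comm]

theorem hasDerivAt_logSumExp {y : ℝ → T → ℝ} {y' : T → ℝ} {s : ℝ}
    (h : ∀ t, HasDerivAt (fun r => y r t) (y' t) s) :
    HasDerivAt (fun r => logSumExp (y r)) (∑ t, softmax (y s) t * y' t) s := by
  refine ((hasDerivAt_sum_exp h).log (sum_exp_pos _).ne').congr_deriv ?_
  rw [Finset.sum_div]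
  refine Finset.sum_congr rfl fun t _ => ?_
  rw [softmax]; ring

theorem hasDerivAt_softmax {y : ℝ → T → ℝ} {y' : T → ℝ} {s : ℝ}
    (h : ∀ t, HasDerivAt (fun r => y r t) (y' t) s) (t : T) :
    HasDerivAt (fun r => softmax (y r) t)
      (softmax (y s) t * (y' t - ∑ u, softmax (y s) u * y' u)) s := by
  have hp := (sum_exp_pos (y s)).ne'
  refine (((h t).exp).div (hasDerivAt_sum_exp h) hp).congr_deriv ?_
  have : ∑ u, softmax (y s) u * y' u
      = (∑ u, Real.exp (y s u) * y' u) / ∑ u, Real.exp (y s u) := by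
    rw [Finset.sum_div]
    refine Finset.sum_congr rfl fun t _ => ?_
    rw [softmax]; ring
  rw [this, softmax]
  field_simp

end LogSumExp

/-! ### Gaussian interpolation and the Sudakov–Fernique comparison. -/

section GaussianProcess
variable {T ι : Type*} [Fintype ι]

/-- The finite Gaussian process `t ↦ ∑ k, m t k * x k`. -/
def gaussProc (m : T → ι → ℝ) (x : ι → ℝ) (t : T) : ℝ := ∑ k, m t k * x k

theorem continuous_gaussProc (m : T → ι → ℝ) : Continuous (gaussProc m) := by
  unfold gaussProc; fun_prop

theorem integrable_coord (k : ι) : Integrable (fun x : ι → ℝ => x k) (stdGauss ι) :=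
  integrable_comp_eval (μ := fun _ : ι => gaussianReal 0 1) (i := k) (f := fun x : ℝ => x)
      integrable_id_gaussianReal

theorem integrable_gaussProc (m : T → ι → ℝ) (t : T) :
    Integrable (fun x => gaussProc m x t) (stdGauss ι) :=
  integrable_finsetSum _ fun k _ => (integrable_coord k).const_mul _

theorem gaussProc_const_mul (r : ℝ) (m : T → ι → ℝ) (x : ι → ℝ) (t : T) :
    gaussProc (fun t k => r * m t k) x t = r * gaussProc m x t := by
  simp [gaussProc, Finset.mul_sum, mul_assoc]

end GaussianProcess

section Interpolation
variable {T ι : Type*} [Fintype T] [Nonempty T] [Fintype ι]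

theorem integrable_of_sandwich {α : Type*} [MeasurableSpace α] {μ : Measure α} {f l u : α → ℝ}
    (hf : AEStronglyMeasurable f μ) (hl : Integrable l μ) (hu : Integrable u μ)
    (h1 : ∀ x, l x ≤ f x) (h2 : ∀ x, f x ≤ u x) : Integrable f μ := by
  refine (hl.abs.add hu.abs).mono' hf (.of_forall fun x => ?_)
  rw [Real.norm_eq_abs, abs_le]
  simp only [Pi.add_apply]
  constructor <;>
  linarith [h1 x, h2 x, neg_abs_le (l x), le_abs_self (u x), abs_nonneg (u x), abs_nonneg (l x)]

theorem integrable_logSumExp_gaussProc (m : T → ι → ℝ) :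
    Integrable (fun x => logSumExp (gaussProc m x)) (stdGauss ι) := by
  obtain ⟨t₀⟩ := ‹Nonempty T›
  have : Nonempty T := ⟨t₀⟩
  refine integrable_of_sandwich
    (continuous_logSumExp.comp (continuous_gaussProc m)).aestronglyMeasurable
    (integrable_gaussProc m t₀) (u := fun x => ∑ t, |gaussProc m x t| + Real.log (Fintype.card T))
    ?_ (fun x => le_logSumExp _ _) fun x => logSumExp_le fun t => ?_
  · exact (integrable_finsetSum _ fun t _ => (integrable_gaussProc m t).abs).add
      (integrable_const _)
  · exact (le_abs_self _).trans (Finset.single_le_sum (f := fun t => |gaussProc m x t|)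
      (fun _ _ => abs_nonneg _) (Finset.mem_univ t))

theorem integral_coord_mul_softmax [DecidableEq ι] (m : T → ι → ℝ) (t : T) (k : ι) :
    ∫ x, x k * softmax (gaussProc m x) t ∂stdGauss ι =
      ∫ x, softmax (gaussProc m x) t *
        (m t k - ∑ u, softmax (gaussProc m x) u * m u k) ∂stdGauss ι := by
  have hs (t : T) : Continuous fun x => softmax (gaussProc m x) t :=
    (continuous_softmax t).comp (continuous_gaussProc m)
  refine stdGauss_integral_mul k (hs t).measurable (Continuous.measurable (by fun_prop))
    (A := 1) (B := |m t k| + ∑ u, |m u k|) (fun x => ?_) (fun x => abs_softmax_le_one _ _) fun x => ?_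
  · have := hasDerivAt_softmax (y := fun s => gaussProc m (Function.update x k s))
      (y' := fun t => m t k) (s := x k) (fun u => ?_) t
    · simpa using this
    · have : ∀ i ∈ Finset.univ, HasDerivAt (fun s => m u i * Function.update x k s i)
          (m u i * (Pi.single k (1 : ℝ) : ι → ℝ) i) (x k) := fun i _ =>
        (hasDerivAt_pi.1 (hasDerivAt_update x k (x k)) i).const_mul _
      refine (HasDerivAt.fun_sum this).congr_deriv ?_
      simp [Pi.single_apply]
  · rw [abs_mul]
    refine (mul_le_of_le_one_left (abs_nonneg _) (abs_softmax_le_one _ _)).trans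
      ((abs_sub _ _).trans ?_)
    gcongr
    refine (Finset.abs_sum_le_sum_abs _ _).trans (Finset.sum_le_sum fun u _ => ?_)
    rw [abs_mul]
    exact mul_le_of_le_one_left (abs_nonneg _) (abs_softmax_le_one _ _)

/-- Derivative of the expected soft maximum along a path of Gaussian processes. -/
theorem hasDerivAt_integral_logSumExp {m m' : ℝ → T → ι → ℝ}
    (hm : ∀ s t k, HasDerivAt (fun r => m r t k) (m' s t k) s) {B : ℝ}
    (hB : ∀ s t k, |m' s t k| ≤ B) (s : ℝ) :
    HasDerivAt (fun r => ∫ x, logSumExp (gaussProc (m r) x) ∂stdGauss ι)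
      (∫ x, (∑ t, softmax (gaussProc (m s) x) t * ∑ k, m' s t k * m s t k
        - ∑ t, ∑ u, softmax (gaussProc (m s) x) t * softmax (gaussProc (m s) x) u *
          ∑ k, m' s t k * m s u k) ∂stdGauss ι) s := by
  classical
  have hs (t : T) : Continuous fun x => softmax (gaussProc (m s) x) t :=
    (continuous_softmax t).comp (continuous_gaussProc _)
  have h1 := (hasDerivAt_integral_of_dominated_loc_of_deriv_le (μ := stdGauss ι) (x₀ := s)
    (F := fun r x => logSumExp (gaussProc (m r) x)) (s := Set.univ)
    (F' := fun r x => ∑ t, softmax (gaussProc (m r) x) t * gaussProc (m' r) x t)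
    (bound := fun x => ∑ t : T, ∑ k, B * |x k|) Filter.univ_mem
    (.of_forall fun r =>
      (continuous_logSumExp.comp (continuous_gaussProc _)).aestronglyMeasurable)
    (integrable_logSumExp_gaussProc _)
    (by
      have := continuous_gaussProc (m' s)
      refine Continuous.aestronglyMeasurable (continuous_finsetSum _ fun t _ => (hs t).mul ?_)
      exact (continuous_apply t).comp this)
    (.of_forall fun x r _ => by
      refine (norm_sum_le _ _).trans (Finset.sum_le_sum fun t _ => ?_)
      rw [norm_mul, Real.norm_eq_abs]
      refine (mul_le_of_le_one_left (norm_nonneg _) (abs_softmax_le_one _ _)).trans ?_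
      refine (norm_sum_le _ _).trans (Finset.sum_le_sum fun k _ => ?_)
      rw [norm_mul, Real.norm_eq_abs]
      exact mul_le_mul_of_nonneg_right (hB _ _ _) (abs_nonneg _))
    (integrable_finsetSum _ fun t _ => integrable_finsetSum _ fun k _ =>
      (integrable_coord k).abs.const_mul B)
    (.of_forall fun x r _ => hasDerivAt_logSumExp fun t =>
      HasDerivAt.fun_sum fun k _ => (hm r t k).mul_const _)).2
  refine h1.congr_deriv ?_
  have hi (t : T) (k : ι) : Integrable (fun x => x k * softmax (gaussProc (m s) x) t) (stdGauss ι) :=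
    (integrable_coord k).mul_bdd (c := 1) (hs t).aestronglyMeasurable
      (.of_forall fun x => abs_softmax_le_one _ _)
  have hi1 (t : T) : Integrable (fun x => softmax (gaussProc (m s) x) t) (stdGauss ι) :=
    Integrable.of_bound (hs t).aestronglyMeasurable 1 (.of_forall fun x => abs_softmax_le_one _ _)
  have hi2 (t u : T) : Integrable (fun x => softmax (gaussProc (m s) x) t *
      softmax (gaussProc (m s) x) u) (stdGauss ι) :=
    (hi1 t).mul_bdd (c := 1) (hs u).aestronglyMeasurable
      (.of_forall fun x => abs_softmax_le_one _ _)
  have e2 (t : T) (k : ι) : ∫ x, softmax (gaussProc (m s) x) t *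
        (m s t k - ∑ u, softmax (gaussProc (m s) x) u * m s u k) ∂stdGauss ι =
      m s t k * ∫ x, softmax (gaussProc (m s) x) t ∂stdGauss ι
      - ∑ u, m s u k * ∫ x, softmax (gaussProc (m s) x) t *
        softmax (gaussProc (m s) x) u ∂stdGauss ι := by
    simp_rw [← integral_const_mul]
    rw [← integral_finsetSum _ fun u _ => (hi2 t u).const_mul _, ← integral_sub]
    · congr 1; ext x
      rw [mul_sub, Finset.mul_sum]
      congr 1
      · ring
      · exact Finset.sum_congr rfl fun u _ => by ring
    · exact (hi1 t).const_mul _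
    · exact integrable_finsetSum _ fun u _ => (hi2 t u).const_mul _
  calc ∫ x, ∑ t, softmax (gaussProc (m s) x) t * gaussProc (m' s) x t ∂stdGauss ι
      = ∫ x, ∑ t, ∑ k, m' s t k * (x k * softmax (gaussProc (m s) x) t) ∂stdGauss ι := by
        congr 1; ext x
        refine Finset.sum_congr rfl fun t _ => ?_
        rw [gaussProc, Finset.mul_sum]
        exact Finset.sum_congr rfl fun k _ => by ring
    _ = ∑ t, ∑ k, m' s t k * ∫ x, x k * softmax (gaussProc (m s) x) t ∂stdGauss ι := by
        rw [integral_finsetSum _ fun t _ => integrable_finsetSum _ fun k _ =>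
          (hi t k).const_mul _]
        refine Finset.sum_congr rfl fun t _ => ?_
        rw [integral_finsetSum _ fun k _ => (hi t k).const_mul _]
        exact Finset.sum_congr rfl fun k _ => integral_const_mul _ _
    _ = ∑ t, (∫ x, softmax (gaussProc (m s) x) t ∂stdGauss ι) * ∑ k, m' s t k * m s t k
        - ∑ t, ∑ u, (∫ x, softmax (gaussProc (m s) x) t *
          softmax (gaussProc (m s) x) u ∂stdGauss ι) * ∑ k, m' s t k * m s u k := by
        simp_rw [integral_coord_mul_softmax, e2, mul_sub, Finset.sum_sub_distrib, Finset.mul_sum]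
        congr 1
        · exact Finset.sum_congr rfl fun t _ => Finset.sum_congr rfl fun k _ => by ring
        · refine Finset.sum_congr rfl fun t _ => ?_
          rw [Finset.sum_comm]
          exact Finset.sum_congr rfl fun t _ => Finset.sum_congr rfl fun k _ => by ring
    _ = _ := by
        rw [integral_sub]
        · congr 1
          · rw [integral_finsetSum _ fun t _ => (hi1 t).mul_const _]
            exact Finset.sum_congr rfl fun t _ => (integral_mul_const _ _).symm
          · rw [integral_finsetSum _ fun t _ => integrable_finsetSum _ fun u _ =>
              (hi2 t u).mul_const _]
            refine Finset.sum_congr rfl fun t _ => ?_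
            rw [integral_finsetSum _ fun u _ => (hi2 t u).mul_const _]
            exact Finset.sum_congr rfl fun u _ => (integral_mul_const _ _).symm
        · exact integrable_finsetSum _ fun t _ => (hi1 t).mul_const _
        · exact integrable_finsetSum _ fun t _ => integrable_finsetSum _ fun u _ =>
            (hi2 t u).mul_const _

/-- Orthogonality makes the two processes independent on one Gaussian space. Along the quarter
circle from `a` to `c`, the derivative of the expected soft maximum is sin s cos s / 2 times the
Gibbs average of the difference of the squared increments, which is nonnegative. -/
theorem integral_logSumExp_le_of_orthogonal {a c : T → ι → ℝ}
    (horth : ∀ t u, ∑ k, a t k * c u k = 0)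
    (h : ∀ t u, ∑ k, (a t k - a u k) ^ 2 ≤ ∑ k, (c t k - c u k) ^ 2) :
    ∫ x, logSumExp (gaussProc a x) ∂stdGauss ι ≤ ∫ x, logSumExp (gaussProc c x) ∂stdGauss ι := by
  set m : ℝ → T → ι → ℝ := fun s t k => Real.cos s * a t k + Real.sin s * c t k with hm
  set m' : ℝ → T → ι → ℝ := fun s t k => -Real.sin s * a t k + Real.cos s * c t k with hm'
  have hd (s t k) : HasDerivAt (fun r => m r t k) (m' s t k) s :=
    ((Real.hasDerivAt_cos s).mul_const _).add ((Real.hasDerivAt_sin s).mul_const _)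
  have hB (s t k) : |m' s t k| ≤ ∑ t, ∑ k, (|a t k| + |c t k|) := by
    have h1 : |m' s t k| ≤ |a t k| + |c t k| := by
      refine (abs_add_le _ _).trans ?_
      rw [abs_mul, abs_mul, abs_neg]
      gcongr
      · exact mul_le_of_le_one_left (abs_nonneg _) (Real.abs_sin_le_one _)
      · exact mul_le_of_le_one_left (abs_nonneg _) (Real.abs_cos_le_one _)
    refine h1.trans ((Finset.single_le_sum (f := fun k => |a t k| + |c t k|)
      (fun _ _ => by positivity) (Finset.mem_univ k)).trans ?_)
    exact Finset.single_le_sum (f := fun t => ∑ k, (|a t k| + |c t k|))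
      (fun _ _ => by positivity) (Finset.mem_univ t)
  have hD := hasDerivAt_integral_logSumExp hd hB
  have hQ (s t u) : ∑ k, m' s t k * m s u k =
      Real.sin s * Real.cos s * (∑ k, c t k * c u k - ∑ k, a t k * a u k) := by
    have h2 : ∑ k, m' s t k * m s u k = Real.sin s * Real.cos s *
        (∑ k, c t k * c u k - ∑ k, a t k * a u k) - Real.sin s ^ 2 * ∑ k, a t k * c u k
        + Real.cos s ^ 2 * ∑ k, a u k * c t k := by
      simp only [mul_sub, Finset.mul_sum, ← Finset.sum_sub_distrib, ← Finset.sum_add_distrib]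
      exact Finset.sum_congr rfl fun k _ => by simp only [hm, hm']; ring
    rw [h2, horth, horth]; ring
  have hmono : MonotoneOn (fun r => ∫ x, logSumExp (gaussProc (m r) x) ∂stdGauss ι)
      (Set.Icc 0 (Real.pi / 2)) := by
    refine monotoneOn_of_hasDerivWithinAt_nonneg (convex_Icc _ _)
      (fun s _ => (hD s).continuousAt.continuousWithinAt)
      (fun s _ => (hD s).hasDerivWithinAt) fun s hs => ?_
    rw [interior_Icc] at hs
    refine integral_nonneg fun x => ?_
    simp only [Pi.zero_apply]
    set p := softmax (gaussProc (m s) x) with hp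
    have p1 : ∑ t, p t = 1 := sum_softmax _
    have p0 : ∀ t, 0 ≤ p t := softmax_nonneg _
    simp only [hQ]
    set S := Real.sin s * Real.cos s
    have hS : 0 ≤ S := mul_nonneg (Real.sin_nonneg_of_nonneg_of_le_pi hs.1.le (by linarith [hs.2, Real.pi_pos]))
      (Real.cos_nonneg_of_neg_pi_div_two_le_of_le (by linarith [hs.1, Real.pi_pos]) hs.2.le)
    -- Polarisation: summed over `t` and `u`, with weights of total mass 1, the increments give
    -- twice the diagonal term minus twice the off-diagonal term of the derivative.
    have e1 (t u : T) : p t * p u * (∑ k, (c t k - c u k) ^ 2 - ∑ k, (a t k - a u k) ^ 2)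
        = p t * (∑ k, c t k * c t k - ∑ k, a t k * a t k) * p u
          + p t * (p u * (∑ k, c u k * c u k - ∑ k, a u k * a u k))
          - 2 * (p t * p u * (∑ k, c t k * c u k - ∑ k, a t k * a u k)) := by
      have (f : T → ι → ℝ) : ∑ k, (f t k - f u k) ^ 2 = ∑ k, f t k * f t k + ∑ k, f u k * f u k
          - 2 * ∑ k, f t k * f u k := by
        rw [Finset.mul_sum, ← Finset.sum_add_distrib, ← Finset.sum_sub_distrib]
        exact Finset.sum_congr rfl fun k _ => by ring
      rw [this, this]; ring
    have e2 : 0 ≤ ∑ t, ∑ u,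
        p t * p u * (∑ k, (c t k - c u k) ^ 2 - ∑ k, (a t k - a u k) ^ 2) :=
      Finset.sum_nonneg fun t _ => Finset.sum_nonneg fun u _ =>
        mul_nonneg (mul_nonneg (p0 t) (p0 u)) (sub_nonneg.2 (h t u))
    simp only [e1, Finset.sum_sub_distrib, Finset.sum_add_distrib, ← Finset.mul_sum,
      ← Finset.sum_mul, p1, mul_one, one_mul] at e2
    have e3 : ∑ t, ∑ u, p t * p u * (S * (∑ k, c t k * c u k - ∑ k, a t k * a u k)) =
        S * ∑ t, ∑ u, p t * p u * (∑ k, c t k * c u k - ∑ k, a t k * a u k) := by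
      simp only [Finset.mul_sum]
      exact Finset.sum_congr rfl fun t _ => Finset.sum_congr rfl fun u _ => by ring
    have e4 : ∑ t, p t * (S * (∑ k, c t k * c t k - ∑ k, a t k * a t k)) =
        S * ∑ t, p t * (∑ k, c t k * c t k - ∑ k, a t k * a t k) := by
      rw [Finset.mul_sum]
      exact Finset.sum_congr rfl fun t _ => by ring
    rw [e3, e4, ← mul_sub]
    exact mul_nonneg hS (by linarith)
  have := hmono (Set.left_mem_Icc.2 (by positivity)) (Set.right_mem_Icc.2 (by positivity))
    (by positivity : (0 : ℝ) ≤ Real.pi / 2)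
  simpa [hm] using this

end Interpolation

theorem gaussProc_elim_zero {T ι κ : Type*} [Fintype ι] [Fintype κ] (a : T → ι → ℝ)
    (x : ι ⊕ κ → ℝ) :
    gaussProc (fun t => Sum.elim (a t) 0) x = gaussProc a fun i => x (Sum.inl i) := by
  ext t; simp [gaussProc, Fintype.sum_sum_type]

theorem gaussProc_zero_elim {T ι κ : Type*} [Fintype ι] [Fintype κ] (c : T → κ → ℝ)
    (x : ι ⊕ κ → ℝ) :
    gaussProc (fun t => Sum.elim 0 (c t)) x = gaussProc c fun i => x (Sum.inr i) := by
  ext t; simp [gaussProc, Fintype.sum_sum_type]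

/-- Sudakov–Fernique comparison for soft maxima. -/
theorem integral_logSumExp_le {T ι κ : Type*} [Fintype T] [Nonempty T] [Fintype ι] [Fintype κ]
    {a : T → ι → ℝ} {c : T → κ → ℝ}
    (h : ∀ t u, ∑ k, (a t k - a u k) ^ 2 ≤ ∑ k, (c t k - c u k) ^ 2) :
    ∫ x, logSumExp (gaussProc a x) ∂stdGauss ι ≤ ∫ x, logSumExp (gaussProc c x) ∂stdGauss κ := by
  have key := integral_logSumExp_le_of_orthogonal (ι := ι ⊕ κ)
    (a := fun t => Sum.elim (a t) 0) (c := fun t => Sum.elim 0 (c t))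
    (by simp [Fintype.sum_sum_type]) (by simpa [Fintype.sum_sum_type] using h)
  have m1 := stdGauss_reindex (Sum.inl_injective (α := ι) (β := κ))
  have m2 := stdGauss_reindex (Sum.inr_injective (α := ι) (β := κ))
  rw [← m1.map_eq, ← m2.map_eq, integral_map m1.aemeasurable, integral_map m2.aemeasurable]
  · simpa [gaussProc_elim_zero, gaussProc_zero_elim] using key
  · exact (continuous_logSumExp.comp (continuous_gaussProc _)).aestronglyMeasurable
  · exact (continuous_logSumExp.comp (continuous_gaussProc _)).aestronglyMeasurable

/-- Sudakov–Fernique comparison, with an arbitrary integrable upper bound for the larger process. -/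
theorem sudakov_fernique {T ι κ : Type*} [Fintype T] [Nonempty T] [Fintype ι] [Fintype κ]
    {a : T → ι → ℝ} {c : T → κ → ℝ}
    (h : ∀ t u, ∑ k, (a t k - a u k) ^ 2 ≤ ∑ k, (c t k - c u k) ^ 2)
    {V : (ι → ℝ) → ℝ} {U : (κ → ℝ) → ℝ} (hV : Integrable V (stdGauss ι))
    (hU : Integrable U (stdGauss κ)) (hVb : ∀ x, ∃ t, V x ≤ gaussProc a x t)
    (hUb : ∀ y t, gaussProc c y t ≤ U y) :
    ∫ x, V x ∂stdGauss ι ≤ ∫ y, U y ∂stdGauss κ := by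
  -- Both processes are scaled by n + 1, the inverse temperature. The error log |T| stays fixed and
  -- is negligible as n grows.
  have key (n : ℕ) : (n + 1) * ∫ x, V x ∂stdGauss ι ≤
      (n + 1) * ∫ y, U y ∂stdGauss κ + Real.log (Fintype.card T) := by
    have h1 := integral_logSumExp_le (a := fun t k => ((n : ℝ) + 1) * a t k)
      (c := fun t k => ((n : ℝ) + 1) * c t k) (fun t u => by
        simp only [← mul_sub, mul_pow, ← Finset.mul_sum]
        exact mul_le_mul_of_nonneg_left (h t u) (by positivity))
    have h2 : (n + 1) * ∫ x, V x ∂stdGauss ι ≤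
        ∫ x, logSumExp (gaussProc (fun t k => ((n : ℝ) + 1) * a t k) x) ∂stdGauss ι := by
      rw [← integral_const_mul]
      refine integral_mono (hV.const_mul _) (integrable_logSumExp_gaussProc _) fun x => ?_
      obtain ⟨t, ht⟩ := hVb x
      refine le_trans ?_ (le_logSumExp _ t)
      rw [gaussProc_const_mul]
      exact mul_le_mul_of_nonneg_left ht (by positivity)
    have h3 : ∫ x, logSumExp (gaussProc (fun t k => ((n : ℝ) + 1) * c t k) x) ∂stdGauss κ ≤
        (n + 1) * ∫ y, U y ∂stdGauss κ + Real.log (Fintype.card T) := by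
      have : (n + 1) * ∫ y, U y ∂stdGauss κ + Real.log (Fintype.card T) =
          ∫ y, ((n + 1) * U y + Real.log (Fintype.card T)) ∂stdGauss κ := by
        rw [integral_add (hU.const_mul _) (integrable_const _), integral_const_mul]
        simp
      rw [this]
      refine integral_mono (integrable_logSumExp_gaussProc _)
        ((hU.const_mul _).add (integrable_const _)) fun x => logSumExp_le fun t => ?_
      rw [gaussProc_const_mul]
      exact mul_le_mul_of_nonneg_left (hUb _ _) (by positivity)
    linarith
  by_contra! hlt
  obtain ⟨n, hn⟩ := exists_nat_gt
    (Real.log (Fintype.card T) / (∫ x, V x ∂stdGauss ι - ∫ y, U y ∂stdGauss κ))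
  rw [div_lt_iff₀ (by linarith)] at hn
  nlinarith [key n]

/-! ### Deterministic bounds on the increments of the quadratic form. -/

/-- For a symmetric matrix `B` there are vectors `S k` with `∑ k, S k ⊗ S k + B` positive
semidefinite, whose coordinatewise square sums are bounded by the row norms of `B`. -/
theorem exists_psd_compensator {n : Type*} [Fintype n] [DecidableEq n] {B : n → n → ℝ}
    (hB : ∀ i j, B j i = B i j) :
    ∃ S : n → n → ℝ, (∀ z : n → ℝ, 0 ≤ ∑ i, ∑ j, B i j * z i * z j + ∑ k, (∑ i, S k i * z i) ^ 2) ∧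
      ∀ i, (∑ k, S k i ^ 2) ^ 2 ≤ ∑ j, B i j ^ 2 := by
  have hA : (Matrix.of B).IsHermitian := by
    ext i j; simp [hB]
  set U : Matrix n n ℝ := (hA.eigenvectorUnitary : Matrix n n ℝ) with hU
  set l := hA.eigenvalues with hl
  have hUU : U * star U = 1 := Unitary.coe_mul_star_self _
  have hUU' : star U * U = 1 := Unitary.coe_star_mul_self _
  have hspec : Matrix.of B = U * Matrix.diagonal l * star U := by
    have := hA.spectral_theorem
    rwa [Unitary.conjStarAlgAut_apply] at this
  have hrow (i : n) : ∑ k, U i k ^ 2 = 1 := by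
    have := congrFun (congrFun hUU i) i
    simpa [Matrix.mul_apply, sq] using this
  have hBU (i j : n) : B i j = ∑ k, l k * (U i k * U j k) := by
    have := congrFun (congrFun hspec i) j
    rw [Matrix.mul_apply] at this
    simp only [Matrix.of_apply, Matrix.mul_diagonal, Matrix.star_apply, star_trivial] at this
    rw [this]
    exact Finset.sum_congr rfl fun k _ => by ring
  have hsq (i : n) : ∑ k, l k ^ 2 * U i k ^ 2 = ∑ j, B i j ^ 2 := by
    have h1 : Matrix.of B * Matrix.of B = U * Matrix.diagonal (fun k => l k * l k) * star U := by
      rw [hspec]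
      calc _ = U * Matrix.diagonal l * (star U * U) * Matrix.diagonal l * star U := by
            simp only [Matrix.mul_assoc]
        _ = _ := by rw [hUU', Matrix.mul_one, Matrix.mul_assoc U, Matrix.diagonal_mul_diagonal]
    have := congrFun (congrFun h1 i) i
    rw [Matrix.mul_apply, Matrix.mul_apply] at this
    simp only [Matrix.of_apply, Matrix.mul_diagonal, Matrix.star_apply, star_trivial] at this
    calc _ = ∑ k, U i k * (l k * l k) * U i k := Finset.sum_congr rfl fun k _ => by ring
      _ = ∑ j, B i j * B j i := this.symm
      _ = _ := Finset.sum_congr rfl fun j _ => by rw [hB i j]; ring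
  -- The witness is a square root of |B|: B + |B| is positive semidefinite because l + |l| ≥ 0, and
  -- Cauchy–Schwarz gives (|B|_ii)² ≤ (B²)_ii since the rows of U are unit vectors.
  refine ⟨fun k i => √|l k| * U i k, fun z => ?_, fun i => ?_⟩
  · have h1 : ∑ i, ∑ j, B i j * z i * z j = ∑ k, l k * (∑ i, U i k * z i) ^ 2 := by
      simp only [hBU, sq, Finset.mul_sum, Finset.sum_mul]
      rw [Finset.sum_comm_cycle]
      refine Finset.sum_congr rfl fun k _ => ?_
      refine Finset.sum_congr rfl fun i _ => Finset.sum_congr rfl fun j _ => ?_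
      ring
    have h2 (k : n) : (∑ i, √|l k| * U i k * z i) ^ 2 = |l k| * (∑ i, U i k * z i) ^ 2 := by
      simp only [mul_assoc]
      rw [← Finset.mul_sum, mul_pow, Real.sq_sqrt (abs_nonneg _)]
    simp only [h1, h2, ← Finset.sum_add_distrib, ← add_mul]
    exact Finset.sum_nonneg fun k _ =>
      mul_nonneg (by linarith [neg_abs_le (l k)]) (sq_nonneg _)
  · simp only [mul_pow, Real.sq_sqrt (abs_nonneg _)]
    have := Finset.sum_mul_sq_le_sq_mul_sq Finset.univ (fun k => |l k| * |U i k|) (fun k => |U i k|)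
    simp only [mul_pow, sq_abs, hrow, hsq, mul_one] at this
    refine le_trans (le_of_eq ?_) this
    congr 1
    refine Finset.sum_congr rfl fun k _ => ?_
    rw [← sq_abs (U i k)]; ring

section Metric
variable {ι : Type*} [Fintype ι]

/-- Since 2(v_i v_j - w_i w_j) = (v_i - w_i)(v_j + w_j) + (v_i + w_i)(v_j - w_j), the square is at
most half the sum of the two squares. Symmetry of β makes the two sums equal, and (v_j + w_j)² ≤
2v_j² + 2w_j². -/
theorem sum_sq_sub_le {β : ι → ι → ℝ} (hs : ∀ i j, β j i = β i j) (h0 : ∀ i j, 0 ≤ β i j)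
    (v w : ι → ℝ) :
    ∑ i, ∑ j, β i j * (v i * v j - w i * w j) ^ 2 ≤
      2 * ∑ i, (v i - w i) ^ 2 * (∑ j, β i j * v j ^ 2 + ∑ j, β i j * w j ^ 2) := by
  have h1 : ∑ i, ∑ j, β i j * ((v i - w i) ^ 2 * (v j + w j) ^ 2) =
      ∑ i, ∑ j, β i j * ((v i + w i) ^ 2 * (v j - w j) ^ 2) := by
    rw [Finset.sum_comm]
    refine Finset.sum_congr rfl fun i _ => Finset.sum_congr rfl fun j _ => ?_
    rw [hs]; ring
  have h2 : ∑ i, ∑ j, β i j * (v i * v j - w i * w j) ^ 2 ≤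
      ∑ i, ∑ j, β i j * ((v i - w i) ^ 2 * (v j + w j) ^ 2) := by
    have : ∑ i, ∑ j, β i j * (v i * v j - w i * w j) ^ 2 ≤ ∑ i, ∑ j,
        (β i j * ((v i - w i) ^ 2 * (v j + w j) ^ 2) / 2 +
          β i j * ((v i + w i) ^ 2 * (v j - w j) ^ 2) / 2) := by
      refine Finset.sum_le_sum fun i _ => Finset.sum_le_sum fun j _ => ?_
      have := mul_le_mul_of_nonneg_left (a := β i j)
        (show (v i * v j - w i * w j) ^ 2 ≤ (v i - w i) ^ 2 * (v j + w j) ^ 2 / 2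
          + (v i + w i) ^ 2 * (v j - w j) ^ 2 / 2 by
          nlinarith [sq_nonneg ((v i - w i) * (v j + w j) - (v i + w i) * (v j - w j))]) (h0 i j)
      linarith
    simp only [Finset.sum_add_distrib, ← Finset.sum_div] at this
    linarith
  refine h2.trans ?_
  rw [Finset.mul_sum]
  refine Finset.sum_le_sum fun i _ => ?_
  rw [← Finset.sum_add_distrib, Finset.mul_sum, Finset.mul_sum]
  refine Finset.sum_le_sum fun j _ => ?_
  have : 0 ≤ β i j * (v i - w i) ^ 2 * (v j - w j) ^ 2 :=
    mul_nonneg (mul_nonneg (h0 i j) (sq_nonneg _)) (sq_nonneg _)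
  nlinarith

/-- Replaces (v_i - w_i)² by increments of v_i p_i(v), at the cost of the quadratic form of β at v²
- w². The compensator `S`, tested at z = v² - w², bounds that form from below. -/
theorem sum_sq_sub_mul_le {β : ι → ι → ℝ} (h0 : ∀ i j, 0 ≤ β i j) {κ : Type*} [Fintype κ]
    {S : κ → ι → ℝ}
    (hS : ∀ z : ι → ℝ, 0 ≤ ∑ i, ∑ j, β i j * z i * z j + ∑ k, (∑ i, S k i * z i) ^ 2)
    (v w : ι → ℝ) :
    ∑ i, (v i - w i) ^ 2 * (∑ j, β i j * v j ^ 2 + ∑ j, β i j * w j ^ 2) ≤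
      4 * ∑ i, (v i * √(∑ j, β i j * v j ^ 2) - w i * √(∑ j, β i j * w j ^ 2)) ^ 2 +
      2 * ∑ k, (∑ i, S k i * v i ^ 2 - ∑ i, S k i * w i ^ 2) ^ 2 := by
  have h1 := hS fun i => v i ^ 2 - w i ^ 2
  have h2 : ∑ i, ∑ j, β i j * (v i ^ 2 - w i ^ 2) * (v j ^ 2 - w j ^ 2) =
      ∑ i, (v i ^ 2 - w i ^ 2) * (∑ j, β i j * v j ^ 2 - ∑ j, β i j * w j ^ 2) := by
    refine Finset.sum_congr rfl fun i _ => ?_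
    rw [← Finset.sum_sub_distrib, Finset.mul_sum]
    exact Finset.sum_congr rfl fun j _ => by ring
  have h2' (k : κ) : ∑ i, S k i * (v i ^ 2 - w i ^ 2) =
      ∑ i, S k i * v i ^ 2 - ∑ i, S k i * w i ^ 2 := by
    rw [← Finset.sum_sub_distrib]
    exact Finset.sum_congr rfl fun i _ => mul_sub _ _ _
  simp only [h2, h2'] at h1
  have h3 : ∑ i, (v i - w i) ^ 2 * (∑ j, β i j * v j ^ 2 + ∑ j, β i j * w j ^ 2) ≤
      ∑ i, (4 * (v i * √(∑ j, β i j * v j ^ 2) - w i * √(∑ j, β i j * w j ^ 2)) ^ 2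
        - 2 * ((v i ^ 2 - w i ^ 2) * (∑ j, β i j * v j ^ 2 - ∑ j, β i j * w j ^ 2))) := by
    refine Finset.sum_le_sum fun i _ => ?_
    have ha : 0 ≤ ∑ j, β i j * v j ^ 2 :=
      Finset.sum_nonneg fun j _ => mul_nonneg (h0 i j) (sq_nonneg _)
    have hb : 0 ≤ ∑ j, β i j * w j ^ 2 :=
      Finset.sum_nonneg fun j _ => mul_nonneg (h0 i j) (sq_nonneg _)
    have ea := Real.sq_sqrt ha
    have eb := Real.sq_sqrt hb
    set p := √(∑ j, β i j * v j ^ 2)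
    set q := √(∑ j, β i j * w j ^ 2)
    rw [← ea, ← eb]
    have hp : 0 ≤ p := Real.sqrt_nonneg _
    have hq : 0 ≤ q := Real.sqrt_nonneg _
    -- Here 2(vp - wq) = (v - w)(p + q) + (v + w)(p - q); subtracting the cross term leaves the two
    -- squares.
    have e : 4 * (v i * p - w i * q) ^ 2 - 2 * ((v i ^ 2 - w i ^ 2) * (p ^ 2 - q ^ 2)) =
        (v i - w i) ^ 2 * (p + q) ^ 2 + ((v i + w i) * (p - q)) ^ 2 := by ring
    rw [e]
    have : 0 ≤ (v i - w i) ^ 2 * (2 * (p * q)) := by positivity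
    nlinarith [sq_nonneg ((v i + w i) * (p - q))]
  rw [Finset.sum_sub_distrib, ← Finset.mul_sum, ← Finset.mul_sum] at h3
  linarith

end Metric

/-- Sums of a symmetric function over all pairs reduce to weighted sums over ordered pairs. -/
theorem sum_lower_triangle {n : ℕ} {F : Fin n → Fin n → ℝ} (hF : ∀ i j, F j i = F i j) :
    ∑ p : {p : Fin n × Fin n // p.2 ≤ p.1}, (if p.1.1 = p.1.2 then 1 else 2) * F p.1.1 p.1.2 =
      ∑ i, ∑ j, F i j := by
  have e1 : ∑ p : {p : Fin n × Fin n // p.2 ≤ p.1},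
      (if p.1.1 = p.1.2 then 1 else 2) * F p.1.1 p.1.2 =
      ∑ i, ∑ j, if j ≤ i then (if i = j then 1 else 2) * F i j else 0 := by
    rw [← Finset.sum_subtype (Finset.univ.filter fun p : Fin n × Fin n => p.2 ≤ p.1) (by simp)
      fun p => (if p.1 = p.2 then 1 else 2) * F p.1 p.2, Finset.sum_filter, Fintype.sum_prod_type]
  have e2 : ∑ i, ∑ j, (if j < i then F i j else 0) = ∑ i, ∑ j, if i < j then F i j else 0 := by
    rw [Finset.sum_comm]
    simp only [hF]
  have e3 : ∑ i, ∑ j, (if j ≤ i then (if i = j then 1 else 2) * F i j else 0) =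
      ∑ i, ∑ j, (if j ≤ i then F i j else 0) + ∑ i, ∑ j, (if j < i then F i j else 0) := by
    simp only [← Finset.sum_add_distrib]
    refine Finset.sum_congr rfl fun i _ => Finset.sum_congr rfl fun j _ => ?_
    rcases lt_trichotomy i j with h | rfl | h
    · simp [h.not_ge, h.not_gt]
    · simp
    · simp [h.le, h, h.ne', two_mul]
  rw [e1, e3, e2]
  simp only [← Finset.sum_add_distrib]
  refine Finset.sum_congr rfl fun i _ => Finset.sum_congr rfl fun j _ => ?_
  rcases lt_or_ge i j with h | h
  · simp [h.not_ge, h]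
  · simp [h, h.not_gt]

theorem sum_lower_triangle_sq_le {n : ℕ} {b z : Fin n → Fin n → ℝ} (hb : ∀ i j, b j i = b i j)
    (hz : ∀ i j, z j i = z i j) :
    ∑ p : {p : Fin n × Fin n // p.2 ≤ p.1},
      ((if p.1.1 = p.1.2 then 1 else 2) * b p.1.1 p.1.2 * z p.1.1 p.1.2) ^ 2 ≤
      2 * ∑ i, ∑ j, b i j ^ 2 * z i j ^ 2 := by
  rw [← sum_lower_triangle fun i j => by rw [hb, hz], Finset.mul_sum]
  refine Finset.sum_le_sum fun p _ => ?_
  have : 0 ≤ b p.1.1 p.1.2 ^ 2 * z p.1.1 p.1.2 ^ 2 := by positivity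
  -- The squared weight is 1 on the diagonal and 4 off it, in both cases at most twice the weight
  -- itself.
  split_ifs <;> nlinarith

/-! ### Discretisation of the spectral norm. -/

/-- A finite net of the unit ball that controls the spectral norm of symmetric matrices. -/
theorem exists_net_specNorm (n : ℕ) : ∃ T : Finset (EuclideanSpace ℝ (Fin n)),
    0 ∈ T ∧ (∀ t ∈ T, ‖t‖ ≤ 1) ∧ ∀ (A : Matrix (Fin n) (Fin n) ℝ), A.IsHermitian → ∀ K : ℝ,
      (∀ t ∈ T, |∑ i, ∑ j, A i j * t i * t j| ≤ K) → specNorm A ≤ 2 * K := by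
  obtain ⟨T₀, hT₀, hfin, hcov⟩ := (isCompact_closedBall (0 : EuclideanSpace ℝ (Fin n))
    1).finite_cover_balls (e := 1 / 4) (by norm_num)
  refine ⟨insert 0 hfin.toFinset, by simp, fun t ht => ?_, fun A hA K hK => ?_⟩
  · rcases Finset.mem_insert.1 ht with rfl | ht
    · simp
    · simpa using hT₀ (hfin.mem_toFinset.1 ht)
  rw [specNorm_eq_l2_opNorm]
  set L := LinearMap.toContinuousLinearMap (Matrix.toEuclideanLin A) with hL
  change ‖L‖ ≤ _
  have hq (v : EuclideanSpace ℝ (Fin n)) : inner ℝ (L v) v = ∑ i, ∑ j, A i j * v i * v j := by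
    simp only [hL, PiLp.inner_apply, LinearMap.coe_toContinuousLinearMap',
      Matrix.toLpLin_apply, Matrix.mulVec, dotProduct, RCLike.inner_apply, conj_trivial,
      Finset.mul_sum]
    exact Finset.sum_congr rfl fun i _ => Finset.sum_congr rfl fun j _ => by ring
  have hsym : (L : EuclideanSpace ℝ (Fin n) →ₗ[ℝ] EuclideanSpace ℝ (Fin n)).IsSymmetric := by
    exact Matrix.isSymmetric_toEuclideanLin_iff.2 hA
  have hball (v : EuclideanSpace ℝ (Fin n)) (hv : ‖v‖ ≤ 1) : |inner ℝ (L v) v| ≤ K + ‖L‖ / 2 := by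
    obtain ⟨t, ht, hvt⟩ := Set.mem_iUnion₂.1 (hcov (by simpa using hv : v ∈ Metric.closedBall 0 1))
    have ht1 : ‖t‖ ≤ 1 := by simpa using hT₀ ht
    have hd : ‖v - t‖ ≤ 1 / 4 := by rw [← dist_eq_norm]; exact (Metric.mem_ball.1 hvt).le
    have h1 := hK t (Finset.mem_insert_of_mem (hfin.mem_toFinset.2 ht))
    rw [← hq] at h1
    -- Each of the two error terms costs ‖L‖/4, so ‖L‖ ≤ K + ‖L‖/2 and hence ‖L‖ ≤ 2K.
    have e : inner ℝ (L v) v = inner ℝ (L t) t + inner ℝ (L v) (v - t) + inner ℝ (L (v - t)) t := by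
      simp only [map_sub, inner_sub_left, inner_sub_right]; ring
    have b1 : |inner ℝ (L v) (v - t)| ≤ ‖L‖ * (1 / 4) := by
      refine (abs_real_inner_le_norm _ _).trans ?_
      gcongr
      exact (L.le_opNorm v).trans (mul_le_of_le_one_right (norm_nonneg _) hv)
    have b2 : |inner ℝ (L (v - t)) t| ≤ ‖L‖ * (1 / 4) := by
      refine (abs_real_inner_le_norm _ _).trans ?_
      refine (mul_le_of_le_one_right (norm_nonneg _) ht1).trans ((L.le_opNorm _).trans ?_)
      gcongr
    rw [e]
    refine (abs_add_three _ _ _).trans ?_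
    linarith
  have hK0 : 0 ≤ K := (abs_nonneg _).trans (hK 0 (Finset.mem_insert_self _ _))
  have : ‖L‖ ≤ K + ‖L‖ / 2 := by
    rw [L.norm_eq_iSup_rayleighQuotient hsym]
    refine ciSup_le fun x => ?_
    -- Restores ‖L‖ on the right-hand side, where the rewrite above also expanded it.
    rw [← L.norm_eq_iSup_rayleighQuotient hsym]
    rcases eq_or_ne x 0 with rfl | hx
    · simp [ContinuousLinearMap.rayleighQuotient]; positivity
    have hx' : ‖x‖ ≠ 0 := norm_ne_zero_iff.2 hx
    have := hball ((‖x‖)⁻¹ • x) (by rw [norm_smul]; simp [hx'])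
    rw [map_smul, inner_smul_left, inner_smul_right] at this
    have e : L.rayleighQuotient x =
        (starRingEnd ℝ) ‖x‖⁻¹ * (‖x‖⁻¹ * inner ℝ (L x) x) := by
      change inner ℝ (L x) x / ‖x‖ ^ 2 = ‖x‖⁻¹ * (‖x‖⁻¹ * inner ℝ (L x) x)
      field_simp
    rwa [e]
  linarith

/-! ### Jensen's inequality for roots and Gaussian moments. -/

theorem integrable_sqrt_and_integral_sqrt_le {α : Type*} [MeasurableSpace α] {μ : Measure α}
    [IsProbabilityMeasure μ] {f : α → ℝ} (hf : Integrable f μ) (h0 : ∀ x, 0 ≤ f x) :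
    Integrable (fun x => √(f x)) μ ∧ ∫ x, √(f x) ∂μ ≤ √(∫ x, f x ∂μ) := by
  have hi : Integrable (fun x => √(f x)) μ := by
    refine integrable_of_sandwich
      (Real.continuous_sqrt.comp_aestronglyMeasurable hf.aestronglyMeasurable)
      (integrable_zero α ℝ μ) (hf.add (integrable_const 1)) (fun x => Real.sqrt_nonneg _) fun x => ?_
    rw [Real.sqrt_le_left (by simpa using add_nonneg (h0 x) zero_le_one)]
    simp only [Pi.add_apply]
    nlinarith [h0 x]
  exact ⟨hi, Real.strictConcaveOn_sqrt.concaveOn.le_map_integral Real.continuous_sqrt.continuousOn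
    isClosed_Ici (.of_forall h0) hf hi⟩

theorem integrable_sqrt_sqrt_and_integral_le {α : Type*} [MeasurableSpace α] {μ : Measure α}
    [IsProbabilityMeasure μ] {f : α → ℝ} (hf : Integrable f μ) (h0 : ∀ x, 0 ≤ f x) :
    Integrable (fun x => √√(f x)) μ ∧ ∫ x, √√(f x) ∂μ ≤ √√(∫ x, f x ∂μ) := by
  obtain ⟨h1, h2⟩ := integrable_sqrt_and_integral_sqrt_le hf h0
  obtain ⟨h3, h4⟩ := integrable_sqrt_and_integral_sqrt_le h1 fun x => Real.sqrt_nonneg _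
  exact ⟨h3, h4.trans (Real.sqrt_le_sqrt h2)⟩

theorem le_sqrt_sqrt {x y : ℝ} (h : x ^ 4 ≤ y) : x ≤ √√y :=
  Real.le_sqrt_of_sq_le (Real.le_sqrt_of_sq_le (by rwa [← pow_mul]))

/-- The variance of the square of a standard Gaussian variable. -/
noncomputable def gaussSqVar : ℝ := ∫ x, (x ^ 2 - 1) ^ 2 ∂gaussianReal 0 1

/-- The fourth moment of a standard Gaussian variable. -/
noncomputable def gaussFourth : ℝ := ∫ x, x ^ 4 ∂gaussianReal 0 1

theorem gaussSqVar_nonneg : 0 ≤ gaussSqVar := integral_nonneg fun _ => sq_nonneg _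

theorem gaussFourth_nonneg : 0 ≤ gaussFourth :=
  integral_nonneg fun x => by simpa using (by positivity : 0 ≤ x ^ 4)

theorem integral_sq_gaussianReal : ∫ x, x ^ 2 ∂gaussianReal 0 1 = 1 := by
  have h := variance_fun_id_gaussianReal (μ := 0) (v := 1)
  rwa [variance_of_integral_eq_zero (by fun_prop) (by simp)] at h

theorem memLp_sq_sub_one : MemLp (fun x : ℝ => x ^ 2 - 1) 2 (gaussianReal 0 1) := by
  rw [memLp_two_iff_integrable_sq (by fun_prop)]
  have : (fun x : ℝ => (x ^ 2 - 1) ^ 2) = fun x => x ^ 4 - 2 * x ^ 2 + 1 := by ext x; ring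
  rw [this]
  exact ((integrable_pow_gaussianReal 4).sub ((integrable_pow_gaussianReal 2).const_mul 2)).add
    (integrable_const _)

/-- Second moment of a weighted sum of centred squares of independent standard Gaussians. -/
theorem integral_sum_sq_sub_one_sq {ι : Type*} [Fintype ι] (r : ι → ℝ) :
    Integrable (fun x : ι → ℝ => (∑ i, r i * (x i ^ 2 - 1)) ^ 2) (stdGauss ι) ∧
    ∫ x : ι → ℝ, (∑ i, r i * (x i ^ 2 - 1)) ^ 2 ∂stdGauss ι = gaussSqVar * ∑ i, r i ^ 2 := by
  have hL (i : ι) : MemLp (fun x : ℝ => r i * (x ^ 2 - 1)) 2 (gaussianReal 0 1) :=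
    memLp_sq_sub_one.const_mul _
  have hL' (i : ι) : MemLp (fun x : ι → ℝ => r i * (x i ^ 2 - 1)) 2 (stdGauss ι) :=
    (hL i).comp_measurePreserving (measurePreserving_eval (fun _ : ι => gaussianReal 0 1) i)
  have h1 : ∫ x : ℝ, (x ^ 2 - 1) ∂gaussianReal 0 1 = 0 := by
    rw [integral_sub (integrable_pow_gaussianReal 2) (integrable_const _),
      integral_sq_gaussianReal]
    simp
  have h2 (i : ι) : ∫ x : ι → ℝ, r i * (x i ^ 2 - 1) ∂stdGauss ι = 0 := by
    rw [integral_comp_eval (μ := fun _ : ι => gaussianReal 0 1)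
      (f := fun x : ℝ => r i * (x ^ 2 - 1)) (by fun_prop), integral_const_mul, h1, mul_zero]
  have hv := variance_sum_pi (μ := fun _ : ι => gaussianReal 0 1) hL
  have e : (∑ i, fun x : ι → ℝ => r i * (x i ^ 2 - 1)) =
      fun x => ∑ i, r i * (x i ^ 2 - 1) := by
    ext x; simp
  rw [e, variance_of_integral_eq_zero (Continuous.aemeasurable (by fun_prop))] at hv
  · refine ⟨?_, hv.trans ?_⟩
    · exact (memLp_finsetSum _ fun i _ => hL' i).integrable_sq
    · rw [gaussSqVar, Finset.mul_sum]
      refine Finset.sum_congr rfl fun i _ => ?_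
      rw [variance_const_mul, variance_of_integral_eq_zero (by fun_prop) h1, mul_comm]
  · rw [integral_finsetSum _ fun i _ => (hL' i).integrable (by norm_num)]
    exact Finset.sum_eq_zero fun i _ => h2 i

/-! ### Expected suprema of the comparison processes. -/

theorem integrable_iSup_gaussProc {T ι : Type*} [Fintype T] [Nonempty T] [Fintype ι]
    (m : T → ι → ℝ) : Integrable (fun x => ⨆ t, gaussProc m x t) (stdGauss ι) := by
  obtain ⟨t₀⟩ := ‹Nonempty T›
  have : Nonempty T := ⟨t₀⟩
  refine integrable_of_sandwich (Measurable.iSup fun t => ?_).aestronglyMeasurable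
    (integrable_gaussProc m t₀) (u := fun x => ∑ t, |gaussProc m x t|)
    (integrable_finsetSum _ fun t _ => (integrable_gaussProc m t).abs)
    (fun x => le_ciSup (f := gaussProc m x) (Set.finite_range _).bddAbove t₀)
    fun x => ciSup_le fun t => ?_
  · exact ((continuous_apply t).comp (continuous_gaussProc m)).measurable
  · exact (le_abs_self _).trans (Finset.single_le_sum (f := fun t => |gaussProc m x t|)
      (fun _ _ => abs_nonneg _) (Finset.mem_univ t))

/-- The Sudakov–Fernique inequality, with an integrable upper bound for the larger process. -/
theorem integral_iSup_gaussProc_le {T ι κ : Type*} [Fintype T] [Nonempty T] [Fintype ι] [Fintype κ]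
    (a : T → ι → ℝ) (c : T → κ → ℝ)
    (h : ∀ t u, ∑ k, (a t k - a u k) ^ 2 ≤ ∑ k, (c t k - c u k) ^ 2)
    {U : (κ → ℝ) → ℝ} (hU : Integrable U (stdGauss κ)) (hUb : ∀ y t, gaussProc c y t ≤ U y) :
    ∫ x, ⨆ t, gaussProc a x t ∂stdGauss ι ≤ ∫ y, U y ∂stdGauss κ := by
  refine sudakov_fernique h (integrable_iSup_gaussProc a) hU (fun x => ?_) hUb
  obtain ⟨t, ht⟩ := exists_eq_ciSup_of_finite (f := gaussProc a x)
  exact ⟨t, ht.ge⟩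

/-- The expected maximum of finitely many Gaussian variables and zero is controlled by the
fourth powers of their standard deviations. -/
theorem integral_iSup_option_le {ι κ : Type*} [Fintype ι] [Fintype κ] (S : κ → ι → ℝ) :
    ∫ x, ⨆ t : Option ι, gaussProc (fun t k => t.elim 0 (S k)) x t ∂stdGauss κ ≤
      √√(4 * gaussFourth * ∑ i, (∑ k, S k i ^ 2) ^ 2) := by
  classical
  set R : ι → ℝ := fun i => ∑ k, S k i ^ 2 with hR
  have hR0 (i : ι) : 0 ≤ R i := Finset.sum_nonneg fun _ _ => sq_nonneg _
  have hq (i : ι) : Integrable (fun y : ι → ℝ => y i ^ 4) (stdGauss ι) :=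
    integrable_comp_eval (μ := fun _ : ι => gaussianReal 0 1) (f := fun x : ℝ => x ^ 4)
      (integrable_pow_gaussianReal 4)
  have hint : Integrable (fun y : ι → ℝ => ∑ i, 4 * R i ^ 2 * y i ^ 4) (stdGauss ι) :=
    integrable_finsetSum _ fun i _ => (hq i).const_mul _
  have h0 (y : ι → ℝ) : 0 ≤ ∑ i, 4 * R i ^ 2 * y i ^ 4 := Finset.sum_nonneg fun i _ => by positivity
  obtain ⟨hi, hle⟩ := integrable_sqrt_sqrt_and_integral_le hint h0
  have hval : ∫ y : ι → ℝ, ∑ i, 4 * R i ^ 2 * y i ^ 4 ∂stdGauss ι =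
      4 * gaussFourth * ∑ i, R i ^ 2 := by
    rw [integral_finsetSum _ fun i _ => (hq i).const_mul _, Finset.mul_sum]
    refine Finset.sum_congr rfl fun i _ => ?_
    rw [integral_const_mul, integral_comp_eval (μ := fun _ : ι => gaussianReal 0 1)
      (f := fun x : ℝ => x ^ 4) (by fun_prop), gaussFourth]
    ring
  rw [hval] at hle
  refine le_trans ?_ hle
  have hs (i : ι) (f : ι → ℝ) :
      ∑ k, (Pi.single i √(2 * R i) : ι → ℝ) k * f k = √(2 * R i) * f i := by
    simp [Pi.single_apply]
  have hs2 (i : ι) : ∑ k, (Pi.single i √(2 * R i) : ι → ℝ) k ^ 2 = 2 * R i := by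
    simp only [sq, hs, Pi.single_eq_same]
    exact Real.mul_self_sqrt (by linarith [hR0 i])
  -- Comparison with independent Gaussians of variance 2 R_i, enough because (x - y)² ≤ 2x² + 2y².
  -- Their maximum is at most their ℓ⁴ norm.
  refine integral_iSup_gaussProc_le (fun (t : Option ι) k => t.elim 0 (S k)) (fun t =>
    t.elim 0 fun i => (Pi.single i √(2 * R i) : ι → ℝ)) (fun t u => ?_) hi fun y t => ?_
  · rcases t with _ | i <;> rcases u with _ | j
    · simp
    · simp only [Option.elim_none, Option.elim_some, Pi.zero_apply, zero_sub, neg_sq, hs2]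
      linarith [hR0 j]
    · simp only [Option.elim_none, Option.elim_some, Pi.zero_apply, sub_zero, hs2]
      linarith [hR0 i]
    · rcases eq_or_ne i j with rfl | hij
      · simp
      simp only [Option.elim_some]
      have e1 : ∑ k, ((Pi.single i √(2 * R i) : ι → ℝ) k - (Pi.single j √(2 * R j) : ι → ℝ) k) ^ 2
          = 2 * R i + 2 * R j := by
        have : ∀ k, ((Pi.single i √(2 * R i) : ι → ℝ) k - (Pi.single j √(2 * R j) : ι → ℝ) k) ^ 2 =
          (Pi.single i √(2 * R i) : ι → ℝ) k ^ 2 + (Pi.single j √(2 * R j) : ι → ℝ) k ^ 2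
          - 2 * ((Pi.single i √(2 * R i) : ι → ℝ) k * (Pi.single j √(2 * R j) : ι → ℝ) k) :=
          fun k => by ring
        simp only [this, Finset.sum_sub_distrib, Finset.sum_add_distrib, ← Finset.mul_sum, hs2, hs]
        simp [Pi.single_eq_of_ne hij]
      rw [e1, hR, Finset.mul_sum, Finset.mul_sum, ← Finset.sum_add_distrib]
      exact Finset.sum_le_sum fun k _ => by nlinarith [sq_nonneg (S k i + S k j)]
  · rcases t with _ | i
    · simp [gaussProc]
    · simp only [gaussProc, Option.elim_some, hs]
      refine le_sqrt_sqrt ?_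
      have : (√(2 * R i) * y i) ^ 4 = 4 * R i ^ 2 * y i ^ 4 := by
        rw [mul_pow, show 4 = 2 * 2 from rfl, pow_mul, Real.sq_sqrt (by linarith [hR0 i])]
        ring
      rw [this]
      exact Finset.single_le_sum (f := fun i => 4 * R i ^ 2 * y i ^ 4) (fun i _ => by positivity)
        (Finset.mem_univ i)

/-- Cauchy–Schwarz against `v` and an exchange of sums leave an average of ∑_i β_ij g_i² with
weights v_j². Each such sum is its mean, at most σ², plus a fluctuation bounded by the ℓ² norm over
all j, which is uniform in `v`. -/
theorem sum_mul_sqrt_mul_le {ι : Type*} [Fintype ι] {β : ι → ι → ℝ} (h0 : ∀ i j, 0 ≤ β i j)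
    {σ : ℝ} (hσ0 : 0 ≤ σ) (hσ : ∀ j, ∑ i, β i j ≤ σ ^ 2) {v : ι → ℝ} (hv : ∑ i, v i ^ 2 ≤ 1)
    (g : ι → ℝ) :
    ∑ i, v i * √(∑ j, β i j * v j ^ 2) * g i ≤
      σ + √√(∑ j, (∑ i, β i j * (g i ^ 2 - 1)) ^ 2) := by
  set W := ∑ j, (∑ i, β i j * (g i ^ 2 - 1)) ^ 2 with hW
  have hW0 : 0 ≤ W := Finset.sum_nonneg fun _ _ => sq_nonneg _
  have ha (i : ι) : 0 ≤ ∑ j, β i j * v j ^ 2 :=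
    Finset.sum_nonneg fun j _ => mul_nonneg (h0 i j) (sq_nonneg _)
  have h1 : (∑ i, v i * √(∑ j, β i j * v j ^ 2) * g i) ^ 2 ≤
      ∑ i, (√(∑ j, β i j * v j ^ 2) * g i) ^ 2 := by
    have := Finset.sum_mul_sq_le_sq_mul_sq Finset.univ v
      (fun i => √(∑ j, β i j * v j ^ 2) * g i)
    simp only [← mul_assoc] at this
    refine this.trans (mul_le_of_le_one_left (Finset.sum_nonneg fun _ _ => sq_nonneg _) hv)
  have h2 : ∑ i, (√(∑ j, β i j * v j ^ 2) * g i) ^ 2 =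
      ∑ j, v j ^ 2 * ∑ i, β i j * g i ^ 2 := by
    simp only [mul_pow, Real.sq_sqrt (ha _), Finset.sum_mul, Finset.mul_sum]
    rw [Finset.sum_comm]
    exact Finset.sum_congr rfl fun i _ => Finset.sum_congr rfl fun j _ => by ring
  have h3 (j : ι) : ∑ i, β i j * g i ^ 2 ≤ σ ^ 2 + √W := by
    have e : ∑ i, β i j * g i ^ 2 = ∑ i, β i j + ∑ i, β i j * (g i ^ 2 - 1) := by
      rw [← Finset.sum_add_distrib]
      exact Finset.sum_congr rfl fun i _ => by ring
    have : ∑ i, β i j * (g i ^ 2 - 1) ≤ √W := Real.le_sqrt_of_sq_le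
      (Finset.single_le_sum (f := fun j => (∑ i, β i j * (g i ^ 2 - 1)) ^ 2)
        (fun _ _ => sq_nonneg _) (Finset.mem_univ j))
    linarith [hσ j]
  have h4 : ∑ j, v j ^ 2 * ∑ i, β i j * g i ^ 2 ≤ σ ^ 2 + √W := by
    calc _ ≤ ∑ j, v j ^ 2 * (σ ^ 2 + √W) :=
          Finset.sum_le_sum fun j _ => mul_le_mul_of_nonneg_left (h3 j) (sq_nonneg _)
      _ ≤ _ := by
          rw [← Finset.sum_mul]
          exact mul_le_of_le_one_left (by positivity) hv
  refine le_of_sq_le_sq ((h1.trans (h2.trans_le h4)).trans ?_) (by positivity)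
  rw [add_sq, Real.sq_sqrt (Real.sqrt_nonneg W)]
  have : 0 ≤ 2 * σ * √√W := by positivity
  linarith

theorem integral_sqrt_sqrt_sum_le {ι : Type*} [Fintype ι] (β : ι → ι → ℝ) :
    Integrable (fun g : ι → ℝ => √√(∑ j, (∑ i, β i j * (g i ^ 2 - 1)) ^ 2)) (stdGauss ι) ∧
    ∫ g : ι → ℝ, √√(∑ j, (∑ i, β i j * (g i ^ 2 - 1)) ^ 2) ∂stdGauss ι ≤
      √√(gaussSqVar * ∑ i, ∑ j, β i j ^ 2) := by
  have h (j : ι) := integral_sum_sq_sub_one_sq fun i => β i j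
  obtain ⟨h1, h2⟩ := integrable_sqrt_sqrt_and_integral_le
    (integrable_finsetSum Finset.univ fun j _ => (h j).1)
    fun x => Finset.sum_nonneg fun j _ => sq_nonneg _
  refine ⟨h1, h2.trans_eq ?_⟩
  rw [integral_finsetSum _ fun j _ => (h j).1]
  simp only [(h _).2, ← Finset.mul_sum]
  rw [Finset.sum_comm]

/-- Gaussian quadratic forms indexed by a finite subset of the unit ball. -/
theorem integral_iSup_quadratic_le {n : ℕ} {b : Fin n → Fin n → ℝ} (hb : ∀ i j, b j i = b i j)
    {σ : ℝ} (hσ0 : 0 ≤ σ) (hσ : ∀ i, ∑ j, b i j ^ 2 ≤ σ ^ 2) {T : Type*} [Fintype T] [Nonempty T]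
    {v : T → Fin n → ℝ} (hv : ∀ t, ∑ i, v t i ^ 2 ≤ 1) {s : ℝ} (hs : s ^ 2 = 1) :
    ∫ x, ⨆ t, gaussProc (fun t (p : {p : Fin n × Fin n // p.2 ≤ p.1}) =>
        s * ((if p.1.1 = p.1.2 then 1 else 2) * b p.1.1 p.1.2 * (v t p.1.1 * v t p.1.2))) x t
        ∂stdGauss _ ≤
      4 * (σ + √√(gaussSqVar * ∑ i, ∑ j, b i j ^ 4)) +
        3 * √√(4 * gaussFourth * ∑ i, ∑ j, b i j ^ 4) := by
  set β : Fin n → Fin n → ℝ := fun i j => b i j ^ 2 with hβ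
  have hβs (i j) : β j i = β i j := by simp [hβ, hb i j]
  have hβ0 (i j) : 0 ≤ β i j := sq_nonneg _
  have h4 : ∑ i, ∑ j, b i j ^ 4 = ∑ i, ∑ j, β i j ^ 2 := by
    simp only [hβ, ← pow_mul]
  obtain ⟨S, hS, hSR⟩ := exists_psd_compensator hβs
  obtain ⟨hWi, hWle⟩ := integral_sqrt_sqrt_sum_le β
  have hM := integral_iSup_option_le S
  have hMi := integrable_iSup_gaussProc (fun (t : Option (Fin n)) k => t.elim 0 (S k))
  set W : (Fin n → ℝ) → ℝ := fun g => √√(∑ j, (∑ i, β i j * (g i ^ 2 - 1)) ^ 2) with hW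
  set M : (Fin n → ℝ) → ℝ := fun x =>
    ⨆ t : Option (Fin n), gaussProc (fun t k => t.elim 0 (S k)) x t with hMdef
  have m1 := stdGauss_reindex (Sum.inl_injective (α := Fin n) (β := Fin n))
  have m2 := stdGauss_reindex (Sum.inr_injective (α := Fin n) (β := Fin n))
  have i1 := (m1.integrable_comp_of_integrable ((integrable_const σ).add hWi)).const_mul 4
  have i2 := (m2.integrable_comp_of_integrable hMi).const_mul 3
  -- The increment bounds multiply to 2 · 2 · 4 = 16 for the first part and 2 · 2 · 2 = 8 for the
  -- second. The coefficients 4 and 3 have squares 16 and 9.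
  have key := integral_iSup_gaussProc_le (fun t (p : {p : Fin n × Fin n // p.2 ≤ p.1}) =>
        s * ((if p.1.1 = p.1.2 then 1 else 2) * b p.1.1 p.1.2 * (v t p.1.1 * v t p.1.2)))
    (fun t => Sum.elim (fun i => 4 * (v t i * √(∑ j, β i j * v t j ^ 2)))
      (fun k => 3 * ∑ i, S k i * v t i ^ 2)) (fun t u => ?_) (i1.add i2) (fun y t => ?_)
  · refine key.trans ?_
    simp only [Pi.add_apply, Function.comp_apply] at i1 i2 ⊢
    rw [integral_add i1 i2, integral_const_mul, integral_const_mul]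
    have e1 : ∫ y : Fin n ⊕ Fin n → ℝ, (σ + W fun i => y (Sum.inl i)) ∂stdGauss _ =
        σ + ∫ g, W g ∂stdGauss _ := by
      have := integral_map m1.aemeasurable (f := fun g => σ + W g)
        (by rw [m1.map_eq]; exact ((integrable_const σ).add hWi).aestronglyMeasurable)
      rw [← this, m1.map_eq, integral_add (integrable_const σ) hWi]
      simp
    have e2 : ∫ y : Fin n ⊕ Fin n → ℝ, (M fun i => y (Sum.inr i)) ∂stdGauss _ =
        ∫ g, M g ∂stdGauss _ := by
      have := integral_map m2.aemeasurable (f := M)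
        (by rw [m2.map_eq]; exact hMi.aestronglyMeasurable)
      rw [← this, m2.map_eq]
    rw [e1, e2, h4]
    have : ∑ i, (∑ k, S k i ^ 2) ^ 2 ≤ ∑ i, ∑ j, β i j ^ 2 := Finset.sum_le_sum fun i _ => hSR i
    have : √√(4 * gaussFourth * ∑ i, (∑ k, S k i ^ 2) ^ 2) ≤
        √√(4 * gaussFourth * ∑ i, ∑ j, β i j ^ 2) :=
      Real.sqrt_le_sqrt (Real.sqrt_le_sqrt (mul_le_mul_of_nonneg_left this
        (by linarith [gaussFourth_nonneg])))
    linarith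
  · have g1 := sum_lower_triangle_sq_le hb
      (z := fun i j => v t i * v t j - v u i * v u j) (fun i j => by ring)
    have g2 := sum_sq_sub_le hβs hβ0 (v t) (v u)
    have g3 := sum_sq_sub_mul_le hβ0 hS (v t) (v u)
    rw [Fintype.sum_sum_type]
    simp only [Sum.elim_inl, Sum.elim_inr, ← mul_sub, mul_pow, hs, one_mul, ← Finset.mul_sum]
    simp only [mul_pow] at g1
    have : 0 ≤ ∑ k, (∑ i, S k i * v t i ^ 2 - ∑ i, S k i * v u i ^ 2) ^ 2 :=
      Finset.sum_nonneg fun _ _ => sq_nonneg _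
    linarith
  · simp only [gaussProc, Fintype.sum_sum_type, Sum.elim_inl, Sum.elim_inr, mul_assoc,
      ← Finset.mul_sum, Pi.add_apply, Function.comp_apply]
    have u1 := sum_mul_sqrt_mul_le hβ0 hσ0 (fun j => by simpa only [hβs] using hσ j) (hv t)
      fun i => y (Sum.inl i)
    have hbdd := (Set.finite_range (gaussProc (fun (t : Option (Fin n)) k => t.elim 0 (S k))
      fun i => y (Sum.inr i))).bddAbove
    -- The weights v_i² sum to at most 1, not exactly 1, so the maximum must be nonnegative; the
    -- index `none` ensures this.
    have hM0 : 0 ≤ M fun i => y (Sum.inr i) := by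
      refine le_trans ?_ (le_ciSup hbdd none)
      simp [gaussProc]
    have u2 : ∑ k, (∑ i, S k i * v t i ^ 2) * y (Sum.inr k) ≤ M fun i => y (Sum.inr i) := by
      calc _ = ∑ i, v t i ^ 2 * gaussProc (fun (t : Option (Fin n)) k => t.elim 0 (S k))
            (fun i => y (Sum.inr i)) (some i) := by
            simp only [gaussProc, Option.elim_some, Finset.sum_mul, Finset.mul_sum]
            rw [Finset.sum_comm]
            exact Finset.sum_congr rfl fun i _ => Finset.sum_congr rfl fun j _ => by ring
        _ ≤ ∑ i, v t i ^ 2 * M fun i => y (Sum.inr i) :=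
            Finset.sum_le_sum fun i _ =>
              mul_le_mul_of_nonneg_left (le_ciSup hbdd (some i)) (sq_nonneg _)
        _ ≤ _ := by
            rw [← Finset.sum_mul]
            exact mul_le_of_le_one_left hM0 (hv t)
    simp only [mul_assoc] at u1
    linarith

/-! ### From the Gaussian process back to the random matrix. -/

theorem continuous_specNorm (n : ℕ) :
    Continuous (specNorm : Matrix (Fin n) (Fin n) ℝ → ℝ) := by
  set L : Matrix (Fin n) (Fin n) ℝ →ₗ[ℝ] EuclideanSpace ℝ (Fin n) →L[ℝ] EuclideanSpace ℝ (Fin n) :=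
    LinearMap.toContinuousLinearMap.toLinearMap ∘ₗ Matrix.toEuclideanLin.toLinearMap
  have h : (specNorm : Matrix (Fin n) (Fin n) ℝ → ℝ) = fun A => ‖L A‖ :=
    funext fun A => specNorm_eq_l2_opNorm A
  rw [h]
  exact continuous_norm.comp (LinearMap.continuous_of_finiteDimensional L)

/-- The symmetric array with prescribed lower triangle. -/
def symmExtend {n : ℕ} (x : {p : Fin n × Fin n // p.2 ≤ p.1} → ℝ) (i j : Fin n) : ℝ :=
  x ⟨(max i j, min i j), min_le_max⟩

theorem symmExtend_comm {n : ℕ} (x : {p : Fin n × Fin n // p.2 ≤ p.1} → ℝ) (i j : Fin n) :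
    symmExtend x j i = symmExtend x i j := by
  simp only [symmExtend, max_comm, min_comm]

theorem symmExtend_apply {n : ℕ} (x : {p : Fin n × Fin n // p.2 ≤ p.1} → ℝ)
    (p : {p : Fin n × Fin n // p.2 ≤ p.1}) : symmExtend x p.1.1 p.1.2 = x p := by
  simp only [symmExtend, max_eq_left p.2, min_eq_right p.2]

theorem gaussProc_quadratic {n : ℕ} {b : Fin n → Fin n → ℝ} (hb : ∀ i j, b j i = b i j)
    {T : Type*} (v : T → Fin n → ℝ) (s : ℝ) (x : {p : Fin n × Fin n // p.2 ≤ p.1} → ℝ) (t : T) :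
    gaussProc (fun t (p : {p : Fin n × Fin n // p.2 ≤ p.1}) =>
      s * ((if p.1.1 = p.1.2 then 1 else 2) * b p.1.1 p.1.2 * (v t p.1.1 * v t p.1.2))) x t =
    s * ∑ i, ∑ j, b i j * symmExtend x i j * v t i * v t j := by
  rw [← sum_lower_triangle (F := fun i j => b i j * symmExtend x i j * v t i * v t j)
    (fun i j => by rw [hb, symmExtend_comm]; ring), gaussProc, Finset.mul_sum]
  refine Finset.sum_congr rfl fun p _ => ?_
  rw [symmExtend_apply]; ring

theorem integral_specNorm_symmExtend_le {n : ℕ} {b : Fin n → Fin n → ℝ}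
    (hb : ∀ i j, b j i = b i j) {σ : ℝ} (hσ0 : 0 ≤ σ) (hσ : ∀ i, ∑ j, b i j ^ 2 ≤ σ ^ 2) :
    Integrable (fun x => specNorm (Matrix.of fun i j => b i j * symmExtend x i j)) (stdGauss _) ∧
    ∫ x, specNorm (Matrix.of fun i j => b i j * symmExtend x i j) ∂stdGauss _ ≤
      4 * (4 * (σ + √√(gaussSqVar * ∑ i, ∑ j, b i j ^ 4)) +
        3 * √√(4 * gaussFourth * ∑ i, ∑ j, b i j ^ 4)) := by
  obtain ⟨T, hT0, hT1, hT⟩ := exists_net_specNorm n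
  have : Nonempty T := ⟨⟨0, hT0⟩⟩
  set a : ℝ → T → {p : Fin n × Fin n // p.2 ≤ p.1} → ℝ := fun s t p =>
    s * ((if p.1.1 = p.1.2 then 1 else 2) * b p.1.1 p.1.2 * (t.1 p.1.1 * t.1 p.1.2)) with ha
  have hv (t : T) : ∑ i, t.1 i ^ 2 ≤ 1 := by
    have := EuclideanSpace.norm_sq_eq t.1
    simp only [Real.norm_eq_abs, sq_abs] at this
    rw [← this]
    exact pow_le_one₀ (norm_nonneg _) (hT1 t t.2)
  have hbd (s : ℝ) (hs : s ^ 2 = 1) := integral_iSup_quadratic_le hb hσ0 hσ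
    (v := fun (t : T) i => t.1 i) hv hs
  have hint (s : ℝ) : Integrable (fun x => ⨆ t, gaussProc (a s) x t) (stdGauss _) :=
    integrable_iSup_gaussProc (a s)
  have hle (s : ℝ) (x) (t : T) : gaussProc (a s) x t ≤ ⨆ t, gaussProc (a s) x t :=
    le_ciSup (f := gaussProc (a s) x) (Set.finite_range _).bddAbove t
  have hg (s : ℝ) (x) (t : T) : gaussProc (a s) x t =
      s * ∑ i, ∑ j, b i j * symmExtend x i j * t.1 i * t.1 j :=
    gaussProc_quadratic hb (fun (t : T) i => t.1 i) s x t
  have hnn (s : ℝ) (x) : 0 ≤ ⨆ t, gaussProc (a s) x t := by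
    refine le_trans ?_ (hle s x ⟨0, hT0⟩)
    rw [hg]; simp
  -- The signs 1 and -1 give the two one-sided suprema. Both are nonnegative because 0 lies in the
  -- net, so their sum bounds the absolute value of the form.
  have hpt (x) : specNorm (Matrix.of fun i j => b i j * symmExtend x i j) ≤
      2 * ((⨆ t, gaussProc (a 1) x t) + ⨆ t, gaussProc (a (-1)) x t) := by
    refine hT _ (by ext i j; simp [hb i j, symmExtend_comm x i j]) _ fun t ht => ?_
    have h1 := hle 1 x ⟨t, ht⟩
    have h2 := hle (-1) x ⟨t, ht⟩
    rw [hg] at h1 h2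
    simp only [Matrix.of_apply]
    rw [abs_le]
    constructor <;> linarith [hnn 1 x, hnn (-1) x]
  have hbound := ((hint 1).add (hint (-1))).const_mul 2
  have hc : Continuous fun x : {p : Fin n × Fin n // p.2 ≤ p.1} → ℝ =>
      specNorm (Matrix.of fun i j => b i j * symmExtend x i j) := by
    refine (continuous_specNorm n).comp (continuous_matrix fun i j => ?_)
    simp only [symmExtend, Matrix.of_apply]
    fun_prop
  have hi := integrable_of_sandwich hc.aestronglyMeasurable (integrable_zero _ ℝ (stdGauss _))
    hbound (fun x => LinearMap.singularValues_nonneg _ 0) hpt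
  refine ⟨hi, (integral_mono hi hbound hpt).trans ?_⟩
  rw [integral_const_mul]
  simp only [Pi.add_apply]
  rw [integral_add (hint 1) (hint (-1))]
  have h1 := hbd 1 (by norm_num)
  have h2 := hbd (-1) (by norm_num)
  linarith

theorem sqrt_sqrt_eq_rpow (x : ℝ) (hx : 0 ≤ x) : √√x = x ^ (1 / 4 : ℝ) := by
  rw [Real.sqrt_eq_rpow, Real.sqrt_eq_rpow, ← Real.rpow_mul hx]
  norm_num

theorem sqrt_sqrt_mul {x : ℝ} (hx : 0 ≤ x) (y : ℝ) : √√(x * y) = √√x * √√y := by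
  rw [Real.sqrt_mul hx, Real.sqrt_mul (Real.sqrt_nonneg x)]

theorem mainTheorem8 :
    ∃ C : ℝ, 0 < C ∧
      ∀ (n : ℕ) (Ω : Type*) [MeasurableSpace Ω] (P : Measure Ω) [IsProbabilityMeasure P]
        (b : Fin n → Fin n → ℝ) (g : Fin n → Fin n → Ω → ℝ),
        (∀ i j, 0 ≤ b i j) →
        (∀ i j, b j i = b i j) →
        (∀ i j, g j i = g i j) →
        (∀ i j, HasLaw (g i j) (gaussianReal 0 1) P) →
        iIndepFun (fun p : {p : Fin n × Fin n // p.2 ≤ p.1} => g p.1.1 p.1.2) P →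
        Integrable (fun ω => specNorm (randomMatrix b g ω)) P ∧
          ∫ ω, specNorm (randomMatrix b g ω) ∂P ≤
            C * ((⨆ i, √(∑ j, b i j ^ 2)) + (∑ i, ∑ j, b i j ^ 4) ^ (1 / 4 : ℝ)) := by
  -- The outer factor 4 is 2 from the net times 2 for the signs; it multiplies the coefficients 4
  -- and 3 of the comparison process.
  refine ⟨16 + 16 * √√gaussSqVar + 12 * √√(4 * gaussFourth), by positivity, ?_⟩
  intro n Ω _ P _ b g _ hb hg hlaw hind
  set σ := ⨆ i, √(∑ j, b i j ^ 2) with hσdef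
  have hσ0 : 0 ≤ σ := Real.iSup_nonneg fun i => Real.sqrt_nonneg _
  have hσ (i : Fin n) : ∑ j, b i j ^ 2 ≤ σ ^ 2 :=
    (Real.sqrt_le_left hσ0).1
      (le_ciSup (f := fun i => √(∑ j, b i j ^ 2)) (Set.finite_range _).bddAbove i)
  have hL : 0 ≤ ∑ i, ∑ j, b i j ^ 4 :=
    Finset.sum_nonneg fun i _ => Finset.sum_nonneg fun j _ => by positivity
  obtain ⟨h1, h2⟩ := integral_specNorm_symmExtend_le hb hσ0 hσ
  set f : ({p : Fin n × Fin n // p.2 ≤ p.1} → ℝ) → ℝ := fun x =>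
    specNorm (Matrix.of fun i j => b i j * symmExtend x i j) with hf
  set G : Ω → {p : Fin n × Fin n // p.2 ≤ p.1} → ℝ := fun ω p => g p.1.1 p.1.2 ω with hG
  -- Everything depends only on the law of the lower triangle, which is the standard Gaussian
  -- measure.
  have hmap : P.map G = stdGauss {p : Fin n × Fin n // p.2 ≤ p.1} := by
    rw [iIndepFun_iff_map_fun_eq_pi_map fun p => (hlaw _ _).aemeasurable] at hind
    rw [hG, hind]
    congr 1
    ext1 p
    exact (hlaw _ _).map_eq
  have hGm : AEMeasurable G P := aemeasurable_pi_iff.2 fun p => (hlaw _ _).aemeasurable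
  have hX : (fun ω => specNorm (randomMatrix b g ω)) = fun ω => f (G ω) := by
    ext ω
    simp only [hf, randomMatrix]
    congr 2
    ext i j
    simp only [symmExtend, hG]
    rcases le_total i j with h | h
    · rw [max_eq_right h, min_eq_left h, hg]
    · rw [max_eq_left h, min_eq_right h]
  rw [← hmap] at h1 h2
  rw [hX]
  refine ⟨h1.comp_aemeasurable hGm, ?_⟩
  rw [← integral_map hGm h1.aestronglyMeasurable]
  refine h2.trans ?_
  rw [sqrt_sqrt_mul gaussSqVar_nonneg, sqrt_sqrt_mul (by linarith [gaussFourth_nonneg]),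
    ← sqrt_sqrt_eq_rpow _ hL]
  set L := √√(∑ i, ∑ j, b i j ^ 4)
  have hL0 : 0 ≤ L := Real.sqrt_nonneg _
  -- Expanding C(σ + L) produces these products as surplus terms.
  have p1 : 0 ≤ √√gaussSqVar * σ := by positivity
  have p2 : 0 ≤ √√(4 * gaussFourth) * σ := by positivity
  nlinarith
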